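/- Let $\mathsf{Ch}$ be the category of nonnegatively graded chain complexes of abelian groups and let $\mathsf{DAb}_{\le 0}$ be the derived category obtained from it by inverting the quasi-isomorphisms. For a functor $F$ from abelian groups to abelian groups let $LF:\mathsf{DAb}_{\le 0}\to\mathsf{DAb}_{\le 0}$ be its derived functor in the sense of Dold and Puppe: $LF(C)$ is the normalized chain complex of $F(K(P))$, where $P\to C$ is a degreewise projective resolution, $K$ is the Dold–Kan functor from chain complexes to simplicial abelian groups, and $F$ is applied in each simplicial degree. Let $SP^2$ be the second symmetric power and $\Gamma_2$ the second divided power, i.e. the degree-two part of the divided power algebra. The natural maps $SP^2(A)\to\Gamma_2(A)$, $xy\mapsto \gamma_1(x)\gamma_1(y)$, and $\Gamma_2(A)\to A\otimes\mathbb Z/2$, $\gamma_2(x)\mapsto x\otimes 1$, $\gamma_1(x)\gamma_1(y)\mapsto 0$, induce, for $C\in\mathsf{DAb}_{\le 0}$ and with $[1]$ denoting the shift that raises the homological degree by one, a sequence of functors of $C$ $$LSP^2(C[1])\xrightarrow{\ i\ } L\Gamma_2(C[1])\xrightarrow{\ p\ } C\otimes^{L}\mathbb Z/2[1].$$ **Proposition.**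 This sequence does not split naturally in $\mathsf{DAb}_{\le 0}$. More precisely: 1. there is no natural transformation $s: C\otimes^L\mathbb Z/2[1]\to L\Gamma_2(C[1])$ of functors of $C\in\mathsf{DAb}_{\le 0}$ with $p\circ s=\mathrm{id}$; 2. there is no natural transformation $r: L\Gamma_2(C[1])\to LSP^2(C[1])$ of functors of $C\in\mathsf{DAb}_{\le 0}$ with $r\circ i=\mathrm{id}$; 3. there is no decomposition $L\Gamma_2(C[1])\simeq LSP^2(C[1])\oplus C\otimes^L\mathbb Z/2[1]$ that is natural in $C\in\mathsf{DAb}_{\le 0}$; that is, there are no natural transformations $u: LSP^2(C[1])\to L\Gamma_2(C[1])$ and $v: C\otimes^L\mathbb Z/2[1]\to L\Gamma_2(C[1])$ that exhibit $L\Gamma_2(C[1])$ as the direct sum of the two outer terms for every $C$. -/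

import Mathlib

/-! Simplicial derived functors in the sense of Dold and Puppe on the derived category of
nonnegatively graded chain complexes of abelian groups, the functors `SP²`, `Γ₂` and `- ⊗ ℤ/2`,
and the sequence of functors `LSP²(C[1]) → LΓ₂(C[1]) → C[1] ⊗ᴸ ℤ/2`. -/

open CategoryTheory

noncomputable section

namespace DerAb

section

open TensorProduct

/-! ### The symmetric square and the second divided power -/

/-- The symmetric square `SP²(A)`: the part of degree two of the symmetric algebra. -/
def symSquare (A : Type) [AddCommGroup A] : Submodule ℤ (SymmetricAlgebra ℤ A) :=
  Submodule.span ℤ {z | ∃ x y : A, z = SymmetricAlgebra.ι ℤ A x * SymmetricAlgebra.ι ℤ A y}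

/-- The second divided power `Γ₂(A)`: the part of degree two of the divided power algebra; it is
generated by the monomials `γ₂(x)` and `γ₁(x) γ₁(y)`. -/
def gammaTwo (A : Type) [AddCommGroup A] : Submodule ℤ (DividedPowerAlgebra ℤ A) :=
  Submodule.span ℤ
    ({z | ∃ x : A, z = DividedPowerAlgebra.dp ℤ 2 x} ∪
     {z | ∃ x y : A, z = DividedPowerAlgebra.dp ℤ 1 x * DividedPowerAlgebra.dp ℤ 1 y})

section
variable {A B C : Type} [AddCommGroup A] [AddCommGroup B] [AddCommGroup C]

/-- Functoriality of `SP²`. -/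
def symSquareMap (f : A →ₗ[ℤ] B) : symSquare A →ₗ[ℤ] symSquare B :=
  (SymmetricAlgebra.lift (SymmetricAlgebra.ι ℤ B ∘ₗ f)).toLinearMap.restrict
    (fun _ hz => (Submodule.span_le.2 (by
      rintro _ ⟨x, y, rfl⟩
      exact Submodule.subset_span ⟨f x, f y, by simp⟩) :
        symSquare A ≤ (symSquare B).comap _) hz)

/-- Functoriality of `Γ₂`, induced by `γᵢ(x) ↦ γᵢ(f x)`. -/
def gammaTwoMap (f : A →ₗ[ℤ] B) : gammaTwo A →ₗ[ℤ] gammaTwo B :=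
  (DividedPowerAlgebra.map ℤ f).toLinearMap.restrict
    (fun _ hz => (Submodule.span_le.2 (by
      rintro _ (⟨x, rfl⟩ | ⟨x, y, rfl⟩)
      · exact Submodule.subset_span (Or.inl ⟨f x, by simp⟩)
      · exact Submodule.subset_span (Or.inr ⟨f x, f y, by simp⟩)) :
        gammaTwo A ≤ (gammaTwo B).comap _) hz)

variable (A) in
/-- The natural map `SP²(A) → Γ₂(A)`, `x y ↦ γ₁(x) γ₁(y)`. -/
def symSquareToGammaTwo : symSquare A →ₗ[ℤ] gammaTwo A :=
  (SymmetricAlgebra.lift (DividedPowerAlgebra.embed ℤ A)).toLinearMap.restrict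
    (fun _ hz => (Submodule.span_le.2 (by
      rintro _ ⟨x, y, rfl⟩
      exact Submodule.subset_span (Or.inr ⟨x, y, by simp [DividedPowerAlgebra.embed_def]⟩)) :
        symSquare A ≤ (gammaTwo A).comap _) hz)

lemma two_zsmul_tensor (z : A ⊗[ℤ] ZMod 2) : (2 : ℤ) • z = 0 := by
  induction z with
  | zero => simp
  | add x y hx hy => rw [smul_add, hx, hy, add_zero]
  | tmul x y =>
    rw [← TensorProduct.tmul_smul]
    have : (2 : ℤ) • y = 0 := by revert y; decide
    rw [this, TensorProduct.tmul_zero]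

lemma even_zsmul_tensor {n : ℤ} (h : Even n) (z : A ⊗[ℤ] ZMod 2) : n • z = 0 := by
  obtain ⟨k, rfl⟩ := h
  rw [← two_mul, mul_comm, mul_smul, two_zsmul_tensor, smul_zero]

/-- The homomorphism `Γ₂(A) → A ⊗ ℤ/2` with `γ₂(x) ↦ x ⊗ 1` and `γ₁(x) γ₁(y) ↦ 0` exists; it is
unique since these elements generate `Γ₂(A)`, see `gammaTwo_hom_ext`. -/
theorem exists_gammaTwoToTensor (A : Type) [AddCommGroup A] :
    ∃ q : gammaTwo A →ₗ[ℤ] A ⊗[ℤ] ZMod 2,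
      (∀ (x : A) (h), q ⟨DividedPowerAlgebra.dp ℤ 2 x, h⟩ = x ⊗ₜ[ℤ] (1 : ZMod 2)) ∧
      (∀ (x y : A) (h),
        q ⟨DividedPowerAlgebra.dp ℤ 1 x * DividedPowerAlgebra.dp ℤ 1 y, h⟩ = 0) := by
  let _ : Module ℤᵐᵒᵖ (A ⊗[ℤ] ZMod 2) :=
    Module.compHom _ ((RingEquiv.toOpposite ℤ).symm.toRingHom)
  have _ : IsCentralScalar ℤ (A ⊗[ℤ] ZMod 2) := ⟨fun _ _ => rfl⟩
  let T := TrivSqZeroExt ℤ (A ⊗[ℤ] ZMod 2)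
  let f : ℕ × A → T := fun p =>
    if p.1 = 0 then 1 else if p.1 = 2 then TrivSqZeroExt.inr (p.2 ⊗ₜ[ℤ] (1 : ZMod 2)) else 0
  let g : DividedPowerAlgebra ℤ A →ₐ[ℤ] T := DividedPowerAlgebra.lift' (f := f)
    (fun _ => rfl)
    (by
      intro n r m
      match n with
      | 0 => simp [f]
      | 1 => simp [f]
      | 2 =>
        simp only [f, OfNat.ofNat_ne_zero, if_false, if_true]
        rw [← TrivSqZeroExt.inr_smul]
        congr 1
        rw [← TensorProduct.smul_tmul', ← sub_eq_zero, ← sub_smul]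
        exact even_zsmul_tensor (by rw [Int.even_sub, Int.even_pow]; simp) _
      | (n + 3) => simp [f])
    (by
      intro n p m
      rcases Nat.eq_zero_or_pos n with rfl | hn
      · simp [f]
      rcases Nat.eq_zero_or_pos p with rfl | hp
      · simp [f]
      by_cases hnp : n = 1 ∧ p = 1
      · obtain ⟨rfl, rfl⟩ := hnp
        simp only [f, one_ne_zero, if_false, OfNat.one_ne_ofNat, mul_zero, Nat.reduceAdd,
          OfNat.ofNat_ne_zero, if_true]
        symm
        rw [← TrivSqZeroExt.inr_smul]
        have := two_zsmul_tensor (m ⊗ₜ[ℤ] (1 : ZMod 2))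
        rw [← TrivSqZeroExt.inr_zero]
        congr 1
        simpa [two_smul] using this
      · have : n + p ≠ 2 := by omega
        have h2 : n + p ≠ 0 := by omega
        simp only [f, hn.ne', hp.ne', this, h2, if_false]
        split_ifs <;> simp [T])
    (by
      intro n u v
      match n with
      | 0 => simp [f]
      | 1 => simp [f, Finset.Nat.antidiagonal_succ]
      | 2 => simp [f, Finset.Nat.antidiagonal_succ, TensorProduct.add_tmul, add_comm]
      | (n + 3) =>
        symm
        simp only [f]
        rw [if_neg (by omega), if_neg (by omega)]
        refine Finset.sum_eq_zero ?_
        rintro ⟨k, l⟩ hkl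
        replace hkl := Finset.HasAntidiagonal.mem_antidiagonal.1 hkl
        dsimp only at hkl ⊢
        split_ifs <;> first | omega | simp [T])
  have hg : ∀ n x, g (DividedPowerAlgebra.dp ℤ n x) = f (n, x) :=
    fun n x => DividedPowerAlgebra.lift'_apply_dp _ _ _ _ n x
  refine ⟨TrivSqZeroExt.sndHom ℤ (A ⊗[ℤ] ZMod 2) ∘ₗ g.toLinearMap ∘ₗ (gammaTwo A).subtype,
    fun x h => ?_, fun x y h => ?_⟩
  · change TrivSqZeroExt.snd (g (DividedPowerAlgebra.dp ℤ 2 x)) = _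
    rw [hg]; simp [f]
  · change TrivSqZeroExt.snd (g (DividedPowerAlgebra.dp ℤ 1 x * DividedPowerAlgebra.dp ℤ 1 y)) = _
    rw [map_mul, hg]; simp [f]

variable (A) in
/-- The natural map `Γ₂(A) → A ⊗ ℤ/2`, `γ₂(x) ↦ x ⊗ 1`, `γ₁(x) γ₁(y) ↦ 0`. -/
def gammaTwoToTensor : gammaTwo A →ₗ[ℤ] A ⊗[ℤ] ZMod 2 := (exists_gammaTwoToTensor A).choose

end

end

section

open TensorProduct

lemma gammaTwoToTensor_dp {A : Type} [AddCommGroup A] (x : A) (h) :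
    gammaTwoToTensor A ⟨DividedPowerAlgebra.dp ℤ 2 x, h⟩ = x ⊗ₜ[ℤ] (1 : ZMod 2) :=
  (exists_gammaTwoToTensor A).choose_spec.1 x h

lemma gammaTwoToTensor_mul {A : Type} [AddCommGroup A] (x y : A) (h) :
    gammaTwoToTensor A ⟨DividedPowerAlgebra.dp ℤ 1 x * DividedPowerAlgebra.dp ℤ 1 y, h⟩ = 0 :=
  (exists_gammaTwoToTensor A).choose_spec.2 x y h

lemma gammaTwo_hom_ext {A M : Type} [AddCommGroup A] [AddCommGroup M] {f g : gammaTwo A →ₗ[ℤ] M}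
    (h1 : ∀ x h, f ⟨DividedPowerAlgebra.dp ℤ 2 x, h⟩ = g ⟨DividedPowerAlgebra.dp ℤ 2 x, h⟩)
    (h2 : ∀ x y h, f ⟨DividedPowerAlgebra.dp ℤ 1 x * DividedPowerAlgebra.dp ℤ 1 y, h⟩ =
      g ⟨DividedPowerAlgebra.dp ℤ 1 x * DividedPowerAlgebra.dp ℤ 1 y, h⟩) : f = g := by
  have key : ∀ z (hz : z ∈ gammaTwo A), f ⟨z, hz⟩ = g ⟨z, hz⟩ := fun z hz => by
    induction hz using Submodule.span_induction with
    | mem z hz =>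
      rcases hz with ⟨x, rfl⟩ | ⟨x, y, rfl⟩
      · exact h1 _ _
      · exact h2 _ _ _
    | zero => exact (map_zero f).trans (map_zero g).symm
    | add x y hx hy ihx ihy =>
      exact (map_add f ⟨x, hx⟩ ⟨y, hy⟩).trans
        ((congrArg₂ (· + ·) ihx ihy).trans (map_add g ⟨x, hx⟩ ⟨y, hy⟩).symm)
    | smul n x hx ih =>
      exact (map_smul f n ⟨x, hx⟩).trans
        ((congrArg (n • ·) ih).trans (map_smul g n ⟨x, hx⟩).symm)
  exact LinearMap.ext fun z => key z.1 z.2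

/-- The functor `SP²`. -/
def SP2 : Ab.{0} ⥤ Ab.{0} where
  obj A := AddCommGrpCat.of (symSquare A)
  map f := AddCommGrpCat.ofHom (symSquareMap f.hom.toIntLinearMap).toAddMonoidHom
  map_id A := by
    refine AddCommGrpCat.hom_ext (AddMonoidHom.ext fun z => Subtype.ext ?_)
    change SymmetricAlgebra.lift (SymmetricAlgebra.ι ℤ A ∘ₗ LinearMap.id) z.1 = z.1
    rw [LinearMap.comp_id, SymmetricAlgebra.lift_ι]
    rfl
  map_comp {A B C} f g := by
    refine AddCommGrpCat.hom_ext (AddMonoidHom.ext fun z => Subtype.ext ?_)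
    change SymmetricAlgebra.lift (SymmetricAlgebra.ι ℤ C ∘ₗ _) z.1 =
      SymmetricAlgebra.lift (SymmetricAlgebra.ι ℤ C ∘ₗ g.hom.toIntLinearMap)
        (SymmetricAlgebra.lift (SymmetricAlgebra.ι ℤ B ∘ₗ f.hom.toIntLinearMap) z.1)
    rw [← AlgHom.comp_apply]
    congr 1
    ext x
    simp

/-- The functor `Γ₂`. -/
def Gamma2 : Ab.{0} ⥤ Ab.{0} where
  obj A := AddCommGrpCat.of (gammaTwo A)
  map f := AddCommGrpCat.ofHom (gammaTwoMap f.hom.toIntLinearMap).toAddMonoidHom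
  map_id A := by
    refine AddCommGrpCat.hom_ext (AddMonoidHom.ext fun z => Subtype.ext ?_)
    change DividedPowerAlgebra.map ℤ LinearMap.id z.1 = z.1
    refine DFunLike.congr_fun (g := AlgHom.id ℤ (DividedPowerAlgebra ℤ A)) ?_ z.1
    refine DividedPowerAlgebra.algHom_ext fun n x => ?_
    simp
  map_comp {A B C} f g := by
    refine AddCommGrpCat.hom_ext (AddMonoidHom.ext fun z => Subtype.ext ?_)
    change DividedPowerAlgebra.map ℤ (g.hom.toIntLinearMap ∘ₗ f.hom.toIntLinearMap) z.1 =
      DividedPowerAlgebra.map ℤ g.hom.toIntLinearMap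
        (DividedPowerAlgebra.map ℤ f.hom.toIntLinearMap z.1)
    rw [← AlgHom.comp_apply]
    refine DFunLike.congr_fun ?_ z.1
    refine DividedPowerAlgebra.algHom_ext fun n x => ?_
    simp

/-- The functor `A ↦ A ⊗ ℤ/2`. -/
def tensorZModTwo : Ab.{0} ⥤ Ab.{0} where
  obj A := AddCommGrpCat.of (A ⊗[ℤ] ZMod 2)
  map f := AddCommGrpCat.ofHom (f.hom.toIntLinearMap.rTensor (ZMod 2)).toAddMonoidHom
  map_id A := by
    refine AddCommGrpCat.hom_ext (AddMonoidHom.ext fun z => ?_)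
    exact LinearMap.congr_fun (LinearMap.rTensor_id (ZMod 2) A) z
  map_comp f g := by
    refine AddCommGrpCat.hom_ext (AddMonoidHom.ext fun z => ?_)
    exact LinearMap.congr_fun
      (LinearMap.rTensor_comp (ZMod 2) g.hom.toIntLinearMap f.hom.toIntLinearMap) z

instance : tensorZModTwo.Additive where
  map_add {A B f g} := by
    refine AddCommGrpCat.hom_ext (AddMonoidHom.ext fun z => ?_)
    exact LinearMap.congr_fun
      (LinearMap.rTensor_add (ZMod 2) f.hom.toIntLinearMap g.hom.toIntLinearMap) z

/-- The natural transformation `SP² → Γ₂`. -/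
def SP2ToGamma2 : SP2 ⟶ Gamma2 where
  app A := AddCommGrpCat.ofHom (symSquareToGammaTwo A).toAddMonoidHom
  naturality A B f := by
    refine AddCommGrpCat.hom_ext (AddMonoidHom.ext fun z => Subtype.ext ?_)
    change SymmetricAlgebra.lift (DividedPowerAlgebra.embed ℤ B)
      (SymmetricAlgebra.lift (SymmetricAlgebra.ι ℤ B ∘ₗ f.hom.toIntLinearMap) z.1) =
      DividedPowerAlgebra.map ℤ f.hom.toIntLinearMap
        (SymmetricAlgebra.lift (DividedPowerAlgebra.embed ℤ A) z.1)
    rw [← AlgHom.comp_apply, ← AlgHom.comp_apply]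
    congr 1
    ext x
    simp [DividedPowerAlgebra.embed_def]

/-- The natural transformation `Γ₂ → - ⊗ ℤ/2`. -/
def Gamma2ToTensor : Gamma2 ⟶ tensorZModTwo where
  app A := AddCommGrpCat.ofHom (gammaTwoToTensor A).toAddMonoidHom
  naturality A B f := by
    refine AddCommGrpCat.hom_ext (AddMonoidHom.ext fun z => ?_)
    refine LinearMap.congr_fun (f := gammaTwoToTensor B ∘ₗ gammaTwoMap f.hom.toIntLinearMap)
      (g := f.hom.toIntLinearMap.rTensor (ZMod 2) ∘ₗ gammaTwoToTensor A) ?_ z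
    refine gammaTwo_hom_ext ?_ ?_
    · intro x h
      have : gammaTwoMap f.hom.toIntLinearMap ⟨DividedPowerAlgebra.dp ℤ 2 x, h⟩ =
        ⟨DividedPowerAlgebra.dp ℤ 2 (f.hom x), Submodule.subset_span (Or.inl ⟨_, rfl⟩)⟩ :=
        Subtype.ext (by simp [gammaTwoMap])
      refine (congrArg _ this).trans ((gammaTwoToTensor_dp _ _).trans ?_)
      refine Eq.trans ?_ (congrArg (f.hom.toIntLinearMap.rTensor (ZMod 2))
        (gammaTwoToTensor_dp x h).symm)
      exact (LinearMap.rTensor_tmul (ZMod 2) f.hom.toIntLinearMap 1 x).symm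
    · intro x y h
      have : gammaTwoMap f.hom.toIntLinearMap
        ⟨DividedPowerAlgebra.dp ℤ 1 x * DividedPowerAlgebra.dp ℤ 1 y, h⟩ =
        ⟨DividedPowerAlgebra.dp ℤ 1 (f.hom x) * DividedPowerAlgebra.dp ℤ 1 (f.hom y),
          Submodule.subset_span (Or.inr ⟨_, _, rfl⟩)⟩ :=
        Subtype.ext (by simp [gammaTwoMap])
      refine (congrArg _ this).trans ((gammaTwoToTensor_mul _ _ _).trans ?_)
      refine Eq.trans ?_ (congrArg (f.hom.toIntLinearMap.rTensor (ZMod 2))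
        (gammaTwoToTensor_mul x y h).symm)
      exact (map_zero _).symm

end

section

/-! ### A functorial projective resolution -/

theorem projective_of_injective {F K : Type} [AddCommGroup F] [AddCommGroup K]
    [Module.Projective ℤ F] (i : K →ₗ[ℤ] F) (hi : Function.Injective i) :
    Module.Projective ℤ K := by
  refine Module.Projective.of_lifting_property'' fun f hf => ?_
  let j : (K →₀ ℤ) →ₗ[ℤ] (K →₀ ℚ) := Finsupp.mapRange.linearMap (Algebra.linearMap ℤ ℚ)
  have hj : Function.Injective j :=
    Finsupp.mapRange_injective _ (by simp) (fun a b h => Int.cast_injective (α := ℚ) h)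
  let Q := (K →₀ ℚ) ⧸ (LinearMap.ker f).map j
  let mk : (K →₀ ℚ) →ₗ[ℤ] Q := Submodule.mkQ _
  have hmk : Function.Surjective mk := Submodule.mkQ_surjective _
  have hmk0 : ∀ x, mk x = 0 → ∃ m, f m = 0 ∧ j m = x := fun x hx =>
    (Submodule.Quotient.mk_eq_zero _).1 hx
  let _ : DivisibleBy Q ℤ := divisibleByOfSMulRightSurj _ _ fun {n} hn x => by
    obtain ⟨y, rfl⟩ := hmk x
    refine ⟨mk ((n : ℚ)⁻¹ • y), ?_⟩
    change n • mk ((n : ℚ)⁻¹ • y) = mk y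
    rw [← map_zsmul]
    congr 1
    ext k
    have : (n : ℚ) ≠ 0 := by exact_mod_cast hn
    simp [this]
  have hk : LinearMap.ker f ≤ LinearMap.ker (mk ∘ₗ j) := fun m hm =>
    (Submodule.Quotient.mk_eq_zero _).2 ⟨m, hm, rfl⟩
  let g : K →ₗ[ℤ] Q := ((LinearMap.ker f).liftQ (mk ∘ₗ j) hk) ∘ₗ
      (f.quotKerEquivOfSurjective hf).symm.toLinearMap
  have hg : ∀ m, g (f m) = mk (j m) := fun m => by
    have : (f.quotKerEquivOfSurjective hf).symm (f m) = (LinearMap.ker f).mkQ m := by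
      rw [LinearEquiv.symm_apply_eq]; rfl
    change ((LinearMap.ker f).liftQ _ hk) ((f.quotKerEquivOfSurjective hf).symm (f m)) = _
    rw [this]
    rfl
  obtain ⟨G, hG⟩ := (Module.Baer.of_divisible Q).extension_property i hi g
  obtain ⟨H, hH⟩ := Module.projective_lifting_property mk G hmk
  have key : ∀ k, ∃ m, f m = k ∧ j m = H (i k) := fun k => by
    obtain ⟨m, rfl⟩ := hf k
    obtain ⟨m', hm', hj'⟩ := hmk0 (H (i (f m)) - j m) (by
      rw [map_sub, ← hg, ← hG, ← hH]; simp)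
    exact ⟨m + m', by rw [map_add, hm', add_zero], by rw [map_add, hj']; abel⟩
  choose h h1 h2 using key
  refine ⟨{ toFun := h, map_add' := fun a b => hj ?_, map_smul' := fun n a => hj ?_ },
    LinearMap.ext h1⟩
  · rw [h2, map_add, map_add, map_add, h2, h2]
  · rw [h2, map_smul, map_smul, map_smul, h2]; rfl

/-- The combinations `∑ n_a [a]` in the free abelian group on the set `A` with `∑ n_a = 0`. -/
def reducedFree (A : Type) [AddCommGroup A] : Submodule ℤ (A →₀ ℤ) :=
  LinearMap.ker (Finsupp.linearCombination ℤ (fun _ : A => (1 : ℤ)))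

instance projective_reducedFree (A : Type) [AddCommGroup A] : Module.Projective ℤ (reducedFree A) :=
  projective_of_injective (reducedFree A).subtype (Submodule.injective_subtype _)

lemma sum_mapDomain {A B : Type} (f : A → B) (z : A →₀ ℤ) :
    Finsupp.linearCombination ℤ (fun _ : B => (1 : ℤ)) (Finsupp.lmapDomain ℤ ℤ f z) =
      Finsupp.linearCombination ℤ (fun _ : A => (1 : ℤ)) z := by
  rw [Finsupp.lmapDomain_apply, Finsupp.linearCombination_mapDomain]; rfl

/-- The reduced free functor; unlike `A ↦ ℤ[A]` it preserves zero morphisms. -/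
def freeFunctor : Ab.{0} ⥤ Ab.{0} where
  obj A := AddCommGrpCat.of (reducedFree A)
  map {A B} f := AddCommGrpCat.ofHom ((Finsupp.lmapDomain ℤ ℤ f).restrict (p := reducedFree A)
    (q := reducedFree B) fun z hz => (sum_mapDomain f z).trans hz).toAddMonoidHom
  map_id A := by
    refine AddCommGrpCat.hom_ext (AddMonoidHom.ext fun z => ?_)
    exact Subtype.ext (Finsupp.mapDomain_id (v := z.1))
  map_comp f g := by
    refine AddCommGrpCat.hom_ext (AddMonoidHom.ext fun z => ?_)
    exact Subtype.ext (Finsupp.mapDomain_comp (v := z.1) (f := f) (g := g))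

instance preservesZero_freeFunctor : freeFunctor.PreservesZeroMorphisms where
  map_zero A B := by
    ext z
    refine Subtype.ext ?_
    have hz : Finsupp.linearCombination ℤ (fun _ : A => (1 : ℤ)) z.1 = 0 := z.2
    change Finsupp.mapDomain (fun _ => 0) z.1 = 0
    rw [Finsupp.mapDomain, ← Finsupp.single_sum]
    rw [Finsupp.linearCombination_apply] at hz
    simp only [smul_eq_mul, mul_one] at hz
    change Finsupp.single 0 (z.1.sum fun _ => id) = 0
    have : (z.1.sum fun _ => id) = 0 := hz
    rw [this, Finsupp.single_zero]

/-- The natural epimorphism `∑ n_a [a] ↦ ∑ n_a a`. -/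
def freeEval : freeFunctor ⟶ 𝟭 Ab.{0} where
  app A := AddCommGrpCat.ofHom
    (Finsupp.linearCombination ℤ (id : A → A) ∘ₗ (reducedFree A).subtype).toAddMonoidHom
  naturality A B f := by
    ext z
    change Finsupp.linearCombination ℤ (id : B → B) (Finsupp.mapDomain f z.1) =
      f.hom.toIntLinearMap (Finsupp.linearCombination ℤ (id : A → A) z.1)
    rw [Finsupp.linearCombination_mapDomain, Finsupp.apply_linearCombination]
    rfl

instance epi_freeEval (A : Ab.{0}) : Epi (freeEval.app A) := by
  rw [AddCommGrpCat.epi_iff_surjective]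
  intro a
  refine ⟨⟨Finsupp.single a 1 - Finsupp.single 0 1, ?_⟩, ?_⟩
  · change Finsupp.linearCombination ℤ (fun _ : A => (1 : ℤ)) _ = 0
    simp
  · change Finsupp.linearCombination ℤ (id : A → A) (Finsupp.single a 1 - Finsupp.single 0 1) = a
    simp

lemma projective_ab (P : Ab.{0}) [Module.Projective ℤ P] : Projective P where
  factors {E X} f e he := by
    obtain ⟨g, hg⟩ := Module.projective_lifting_property e.hom.toIntLinearMap
      f.hom.toIntLinearMap ((AddCommGrpCat.epi_iff_surjective e).1 he)
    exact ⟨AddCommGrpCat.ofHom g.toAddMonoidHom,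
      AddCommGrpCat.hom_ext (AddMonoidHom.ext fun x => LinearMap.congr_fun hg x)⟩

lemma projective_of_mono {K P : Ab.{0}} [Module.Projective ℤ P] (i : K ⟶ P) [Mono i] :
    Projective K :=
  have := projective_of_injective i.hom.toIntLinearMap ((AddCommGrpCat.mono_iff_injective i).1 ‹_›)
  projective_ab K

instance moduleProjective_freeFunctor (A : Ab.{0}) : Module.Projective ℤ (freeFunctor.obj A) :=
  inferInstanceAs (Module.Projective ℤ (reducedFree A))

instance projective_freeFunctor (A : Ab.{0}) : Projective (freeFunctor.obj A) := projective_ab _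

end

section

open Simplicial Opposite

/-! ### Chain homotopies give simplicial homotopies under the Dold-Kan correspondence -/

lemma simplex_hom_ext {a b : SimplexCategory} {f g : a ⟶ b}
    (h : ∀ i, (f.toOrderHom i).val = (g.toOrderHom i).val) : f = g := by
  apply SimplexCategory.Hom.ext
  ext i
  exact h i

lemma comp_val {a b c : SimplexCategory} (f : a ⟶ b) (g : b ⟶ c) (i : Fin (a.len + 1)) :
    ((f ≫ g).toOrderHom i).val = (g.toOrderHom (f.toOrderHom i)).val := rfl

lemma δ_val {n : ℕ} (i : Fin (n + 2)) (j : Fin (n + 1)) :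
    ((SimplexCategory.δ i).toOrderHom j).val = if j.val < i.val then j.val else j.val + 1 := by
  change (Fin.succAbove i j).val = _
  simp only [Fin.succAbove, Fin.lt_def, Fin.val_castSucc]
  split_ifs <;> simp

lemma σ_val {n : ℕ} (i : Fin (n + 1)) (j : Fin (n + 2)) :
    ((SimplexCategory.σ i).toOrderHom j).val = if j.val ≤ i.val then j.val else j.val - 1 := by
  change (Fin.predAbove i j).val = _
  simp only [Fin.predAbove, Fin.lt_def, Fin.val_castSucc]
  split_ifs <;> first | omega | simp

/-- Add a new last vertex. -/
def snocHom {a b : SimplexCategory} (f : a ⟶ b) :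
    SimplexCategory.mk (a.len + 1) ⟶ SimplexCategory.mk (b.len + 1) :=
  SimplexCategory.mkHom
    { toFun := fun i =>
        if h : i.val < a.len + 1 then (f.toOrderHom ⟨i.val, h⟩).castSucc else Fin.last _
      monotone' := by
        intro i j hij
        dsimp only
        have hij' : i.val ≤ j.val := hij
        split_ifs with h1 h2
        · exact Fin.castSucc_le_castSucc_iff.2 (f.toOrderHom.monotone hij')
        · exact Fin.le_last _
        · omega
        · exact le_rfl }

lemma snocHom_val {a b : SimplexCategory} (f : a ⟶ b) (i : Fin (a.len + 2)) :
    ((snocHom f).toOrderHom i).val =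
      if h : i.val < a.len + 1 then (f.toOrderHom ⟨i.val, h⟩).val else b.len + 1 := by
  change Fin.val (dite _ _ _) = _
  split_ifs <;> rfl

/-- Add a new last vertex. -/
def snocFunctor : SimplexCategory ⥤ SimplexCategory where
  obj a := SimplexCategory.mk (a.len + 1)
  map f := snocHom f
  map_id a := by
    refine simplex_hom_ext fun i => ?_
    rw [snocHom_val]
    split_ifs with h
    · rfl
    · have : i.val = a.len + 1 := by
        have := i.isLt
        dsimp at this
        omega
      exact this.symm
  map_comp {a b c} f g := by
    refine simplex_hom_ext fun i => ?_
    rw [snocHom_val, comp_val, snocHom_val]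
    by_cases h : i.val < a.len + 1
    · rw [dif_pos h, dif_pos (by rw [snocHom_val, dif_pos h]; exact Fin.isLt _), comp_val]
      congr 2
      apply Fin.ext
      dsimp only
      rw [snocHom_val, dif_pos h]
    · rw [dif_neg h, dif_neg (by rw [snocHom_val, dif_neg h]; omega)]

/-- Send the vertices after `j` to the last vertex. -/
def collapse {n : ℕ} (j : ℕ) : (⦋n⦌ : SimplexCategory) ⟶ ⦋n⦌ :=
  SimplexCategory.mkHom
    { toFun := fun i => if i.val ≤ j then i else Fin.last n
      monotone' := by
        intro a b hab
        have hab' : a.val ≤ b.val := hab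
        dsimp only
        split_ifs
        · exact hab
        · exact Fin.le_last _
        · omega
        · exact le_rfl }

lemma collapse_val {n : ℕ} (j : ℕ) (i : Fin (n + 1)) :
    ((collapse (n := n) j).toOrderHom i).val = if i.val ≤ j then i.val else n := by
  change Fin.val (ite _ _ _) = _
  split_ifs <;> rfl

section
variable {C : Type*} [Category C] (Y : SimplicialObject C)

lemma map_square {a b b' c : SimplexCategory} (g : a ⟶ b) (f : b ⟶ c) (g' : a ⟶ b')
    (f' : b' ⟶ c) (h : ∀ i, (f.toOrderHom (g.toOrderHom i)).val =
      (f'.toOrderHom (g'.toOrderHom i)).val) :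
    Y.map f.op ≫ Y.map g.op = Y.map f'.op ≫ Y.map g'.op := by
  rw [← Y.map_comp, ← Y.map_comp, ← op_comp, ← op_comp,
    simplex_hom_ext (f := g ≫ f) (g := g' ≫ f') h]

lemma map_triangle {a b c : SimplexCategory} (g : a ⟶ b) (f : b ⟶ c) (k : a ⟶ c)
    (h : ∀ i, (f.toOrderHom (g.toOrderHom i)).val = (k.toOrderHom i).val) :
    Y.map f.op ≫ Y.map g.op = Y.map k.op := by
  rw [← Y.map_comp, ← op_comp, simplex_hom_ext (f := g ≫ f) (g := k) h]

/-- The decalage of a simplicial object. -/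
def Dec : SimplicialObject C := snocFunctor.op ⋙ Y

/-- The inclusion of the old vertices. -/
def topFace (a : SimplexCategory) : a ⟶ SimplexCategory.mk (a.len + 1) :=
  SimplexCategory.δ (n := a.len) (Fin.last (a.len + 1))

lemma topFace_val (a : SimplexCategory) (i : Fin (a.len + 1)) :
    ((topFace a).toOrderHom i).val = i.val := by
  have := i.isLt
  refine (δ_val (n := a.len) _ i).trans ?_
  rw [if_pos (by simpa using this)]

/-- The constant map to the new vertex. -/
def topVertex (a : SimplexCategory) : a ⟶ SimplexCategory.mk (a.len + 1) :=
  SimplexCategory.const a (SimplexCategory.mk (a.len + 1)) (Fin.last (a.len + 1))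

lemma topVertex_val (a : SimplexCategory) (i : Fin (a.len + 1)) :
    ((topVertex a).toOrderHom i).val = a.len + 1 := rfl

/-- The map from the decalage given by the last face operators. -/
def decEv : Dec Y ⟶ Y where
  app a := Y.map (topFace a.unop).op
  naturality a b f := map_square Y (topFace b.unop) (snocHom f.unop) f.unop (topFace a.unop)
    fun i => by
      have h := topFace_val b.unop i
      have h' : ((topFace b.unop).toOrderHom i).val < b.unop.len + 1 := h.trans_lt i.isLt
      rw [topFace_val]
      refine (snocHom_val f.unop _).trans ((dif_pos h').trans ?_)
      congr 2
      exact Fin.ext h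

/-- The map from the decalage that factors through the last vertex. -/
def decConst : Dec Y ⟶ Y where
  app a := Y.map (topVertex a.unop).op
  naturality a b f := map_square Y (topVertex b.unop) (snocHom f.unop) f.unop (topVertex a.unop)
    fun i => by
      have h : ¬ ((topVertex b.unop).toOrderHom i).val < b.unop.len + 1 := by
        rw [topVertex_val]; omega
      exact (snocHom_val f.unop _).trans (dif_neg h)

/-- The standard contraction of the decalage. -/
def decHomotopy : SimplicialObject.Homotopy (decEv Y) (decConst Y) where
  h {n} i := Y.map (collapse (n := n + 1) i.val).op
  h_zero_comp_δ_zero n :=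
    map_triangle Y (SimplexCategory.δ (n := n) 0) (collapse (n := n + 1) 0) (topVertex ⦋n⦌)
      fun i => by
        rw [topVertex_val, collapse_val, δ_val]
        simp
  h_last_comp_δ_last n :=
    map_triangle Y (SimplexCategory.δ (n := n) (Fin.last (n + 1))) (collapse (n := n + 1) n)
      (topFace ⦋n⦌) fun i => by
        have := i.isLt
        rw [topFace_val, collapse_val, δ_val]
        simp at this ⊢
        split_ifs <;> omega
  h_succ_comp_δ_castSucc_of_lt {n} i j hij :=
    map_square Y (SimplexCategory.δ i.castSucc) (collapse j.succ.val)
      (collapse j.val) (snocHom (SimplexCategory.δ i)) fun k => by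
        have := k.isLt
        have hij' : i.val ≤ j.val := hij
        simp only [collapse_val, δ_val, snocHom_val]
        simp at this ⊢
        split_ifs <;> omega
  h_succ_comp_δ_castSucc_succ {n} j :=
    map_square Y (SimplexCategory.δ j.castSucc.succ) (collapse j.succ.val)
      (SimplexCategory.δ j.castSucc.succ) (collapse j.castSucc.val) fun k => by
        have := k.isLt
        simp only [collapse_val, δ_val, snocHom_val]
        simp at this ⊢
        split_ifs <;> omega
  h_castSucc_comp_δ_succ_of_lt {n} i j hij :=
    map_square Y (SimplexCategory.δ i.succ) (collapse j.castSucc.val)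
      (collapse j.val) (snocHom (SimplexCategory.δ i)) fun k => by
        have := k.isLt
        have hij' : j.val < i.val := hij
        simp only [collapse_val, δ_val, snocHom_val]
        simp at this ⊢
        split_ifs <;> omega
  h_comp_σ_castSucc_of_le {n} i j hij :=
    map_square Y (SimplexCategory.σ i.castSucc) (collapse j.val)
      (collapse j.succ.val) (snocHom (SimplexCategory.σ i)) fun k => by
        have := k.isLt
        have hij' : i.val ≤ j.val := hij
        simp only [collapse_val, σ_val, snocHom_val]
        simp at this ⊢
        split_ifs <;> omega
  h_comp_σ_succ_of_lt {n} i j hij :=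
    map_square Y (SimplexCategory.σ i.succ) (collapse j.val)
      (collapse j.castSucc.val) (snocHom (SimplexCategory.σ i)) fun k => by
        have := k.isLt
        have hij' : j.val ≤ i.val := hij
        simp only [collapse_val, σ_val, snocHom_val]
        simp at this ⊢
        split_ifs <;> omega

instance : Epi (decEv Y) := by
  have : ∀ a, Epi ((decEv Y).app a) := fun a => by
    have : Y.map (SimplexCategory.σ (n := a.unop.len) (Fin.last _)).op ≫ (decEv Y).app a = 𝟙 _ := by
      refine (map_triangle Y (topFace a.unop) (SimplexCategory.σ (n := a.unop.len) (Fin.last _))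
        (𝟙 a.unop) fun i => ?_).trans (Y.map_id _)
      refine (σ_val (n := a.unop.len) _ _).trans ?_
      have := i.isLt
      rw [topFace_val, if_pos (by simp; omega)]
      rfl
    exact epi_of_epi_fac this
  exact NatTrans.epi_of_epi_app _

lemma decConst_app_succ (k : ℕ) :
    (decConst Y).app (op ⦋k + 1⦌) =
      (Dec Y).δ (0 : Fin (k + 1)).succ ≫ (decConst Y).app (op ⦋k⦌) ≫ Y.σ 0 := by
  have h1 : (decConst Y).app (op ⦋k⦌) ≫ Y.σ 0 = (Dec Y).σ 0 ≫ (decConst Y).app (op ⦋k + 1⦌) :=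
    ((decConst Y).naturality (SimplexCategory.σ (n := k) 0).op).symm
  rw [h1]
  refine Eq.trans ?_ (congrArg (fun t => t ≫ _) (Y.map_comp
    (snocHom (SimplexCategory.δ (n := k) (0 : Fin (k + 1)).succ)).op
    (snocHom (SimplexCategory.σ (n := k) 0)).op) |>.trans (Category.assoc _ _ _))
  symm
  refine map_triangle Y (topVertex ⦋k + 1⦌) _ (topVertex ⦋k + 1⦌) fun i => ?_
  rw [comp_val, topVertex_val]
  refine (snocHom_val (SimplexCategory.δ (n := k) (0 : Fin (k + 1)).succ) _).trans (dif_neg ?_)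
  have h2 : ((snocHom (SimplexCategory.σ (n := k) 0)).toOrderHom
      ((topVertex ⦋k + 1⦌).toOrderHom i)).val = k + 1 :=
    (snocHom_val (SimplexCategory.σ (n := k) 0) _).trans (dif_neg (by
      rw [topVertex_val]; exact lt_irrefl _))
  exact (h2.trans_ge (le_refl (k + 1))).not_gt

end

section
variable {C : Type*} [Category C] [Preadditive C] {X Y : SimplicialObject C}

/-- The sum of two simplicial homotopies. -/
def simplicialHomotopyAdd {f g f' g' : X ⟶ Y} (H : SimplicialObject.Homotopy f g)
    (H' : SimplicialObject.Homotopy f' g') : SimplicialObject.Homotopy (f + f') (g + g') where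
  h i := H.h i + H'.h i
  h_zero_comp_δ_zero n := by simp
  h_last_comp_δ_last n := by simp
  h_succ_comp_δ_castSucc_of_lt i j hij := by simp [hij]
  h_succ_comp_δ_castSucc_succ j := by
    simp [SimplicialObject.Homotopy.h_succ_comp_δ_castSucc_succ]
  h_castSucc_comp_δ_succ_of_lt i j hij := by simp [hij]
  h_comp_σ_castSucc_of_le i j hij := by simp [hij]
  h_comp_σ_succ_of_lt i j hij := by simp [hij]

end

section
open Abelian.DoldKan
variable {A : Type*} [Category A] [Abelian A]

instance : (equivalence (A := A)).inverse.Additive :=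
  Functor.additive_of_preserves_binary_products _

instance : (Γ (A := A)).Additive :=
  inferInstanceAs (equivalence (A := A)).inverse.Additive

instance : (N (A := A)).IsEquivalence :=
  inferInstanceAs (equivalence (A := A)).functor.IsEquivalence

lemma moore_map_decConst (Y : SimplicialObject A) (k : ℕ) :
    ((AlgebraicTopology.normalizedMooreComplex A).map (decConst Y)).f (k + 1) = 0 := by
  have hn := congrArg (fun t => HomologicalComplex.Hom.f t (k + 1))
    ((AlgebraicTopology.inclusionOfMooreComplex A).naturality (decConst Y))
  have hm : Mono ((AlgebraicTopology.inclusionOfMooreComplexMap Y).f (k + 1)) :=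
    inferInstanceAs (Mono (Subobject.arrow _))
  refine (cancel_mono ((AlgebraicTopology.inclusionOfMooreComplexMap Y).f (k + 1))).1 ?_
  refine Eq.trans ?_ Limits.zero_comp.symm
  refine hn.trans ?_
  change (AlgebraicTopology.inclusionOfMooreComplexMap (Dec Y)).f (k + 1) ≫
    (decConst Y).app (op ⦋k + 1⦌) = 0
  rw [decConst_app_succ]
  refine (Category.assoc _ _ _).symm.trans ?_
  rw [AlgebraicTopology.DoldKan.HigherFacesVanish.inclusionOfMooreComplexMap
    (X := Dec Y) k 0 (by simp), Limits.zero_comp]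

lemma N_map_decConst (Y : SimplicialObject A) (k : ℕ) : (N.map (decConst Y)).f (k + 1) = 0 :=
  moore_map_decConst Y k

/-- The isomorphism `N Γ ≅ 𝟭` of the Dold-Kan correspondence. -/
def counit : Γ (A := A) ⋙ N ≅ 𝟭 (ChainComplex A ℕ) := (equivalence (A := A)).counitIso

lemma null_map_zero {K : ChainComplex A ℕ} {Y : SimplicialObject A}
    (h : ∀ i j, K.X i ⟶ (N.obj (Dec Y)).X j) :
    Homotopy.nullHomotopicMap h ≫ N.map (decConst Y) = 0 := by
  rw [Homotopy.nullHomotopicMap_comp]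
  have h0 : ∀ i j, j ≠ 0 → h i j ≫ (N.map (decConst Y)).f j = 0 := by
    intro i j hj
    obtain ⟨k, rfl⟩ := Nat.exists_eq_succ_of_ne_zero hj
    rw [N_map_decConst, Limits.comp_zero]
  ext i : 1
  rcases i with _ | i
  · rw [Homotopy.nullHomotopicMap_f_of_not_rel_left (k₁ := 1) (k₀ := 0) (by simp) (by simp)]
    rw [h0 _ _ one_ne_zero, Limits.zero_comp]; rfl
  · rw [Homotopy.nullHomotopicMap_f (k₂ := i + 2) (k₁ := i + 1) (k₀ := i) (by simp) (by simp)]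
    rw [h0 _ _ (Nat.succ_ne_zero _), h0 _ _ (Nat.succ_ne_zero _)]
    simp

lemma exists_lift_Dec {K L : ChainComplex A ℕ} [∀ n, Projective (K.X n)] {u v : K ⟶ L}
    (H : Homotopy u v) :
    ∃ φ : Γ.obj K ⟶ Dec (Γ.obj L), φ ≫ decEv _ = Γ.map u - Γ.map v ∧ φ ≫ decConst _ = 0 := by
  let w : K ⟶ N.obj (Γ.obj L) := (u - v) ≫ counit.inv.app L
  let H' : Homotopy w 0 :=
    ((Homotopy.equivSubZero H).compRight (counit.inv.app L)).trans
      (Homotopy.ofEq Limits.zero_comp)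
  let h' : ∀ i j, K.X i ⟶ (N.obj (Dec (Γ.obj L))).X j := fun i j =>
    Projective.factorThru (H'.hom i j) ((N.map (decEv (Γ.obj L))).f j)
  let ψ : K ⟶ N.obj (Dec (Γ.obj L)) := Homotopy.nullHomotopicMap h'
  have h1 : ψ ≫ N.map (decEv _) = w := by
    rw [Homotopy.nullHomotopicMap_comp]
    ext i
    simp only [h', Projective.factorThru_comp]
    rw [H'.comm i]
    simp [Homotopy.nullHomotopicMap]
  have h2 : ψ ≫ N.map (decConst _) = 0 := null_map_zero h'
  have hn := counit.hom.naturality (u - v)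
  refine ⟨N.preimage (counit.hom.app K ≫ ψ), N.map_injective ?_, N.map_injective ?_⟩
  · rw [N.map_comp, N.map_preimage, ← Γ.map_sub]
    refine (Category.assoc _ _ _).trans ?_
    rw [h1]
    refine (Category.assoc _ _ _).symm.trans ?_
    refine (congrArg (fun t => t ≫ counit.inv.app L) hn.symm).trans ?_
    refine (Category.assoc _ _ _).trans ?_
    rw [Iso.hom_inv_id_app]
    exact Category.comp_id _
  · rw [N.map_comp, N.map_preimage]
    refine (Category.assoc _ _ _).trans ?_
    rw [h2, Limits.comp_zero, Functor.map_zero]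

lemma nonempty_simplicialHomotopy {K L : ChainComplex A ℕ} [∀ n, Projective (K.X n)] {u v : K ⟶ L}
    (H : Homotopy u v) : Nonempty (SimplicialObject.Homotopy (Γ.map u) (Γ.map v)) := by
  obtain ⟨φ, h1, h2⟩ := exists_lift_Dec H
  have := simplicialHomotopyAdd (SimplicialObject.Homotopy.refl (Γ.map v))
    ((decHomotopy (Γ.obj L)).precomp φ)
  rw [h1, h2] at this
  simp at this
  exact ⟨this⟩

end

end

section

section
open HomologicalComplex Limits
variable {A : Type*} [Category A] [Abelian A] {S : ShortComplex (ChainComplex A ℕ)}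

lemma exists_lift_of_shortExact (hS : S.ShortExact) {T : A} {n : ℕ} (f : T ⟶ S.X₂.X n)
    (hf : f ≫ S.g.f n = 0) : ∃ k : T ⟶ S.X₁.X n, k ≫ S.f.f n = f := by
  have h := hS.map_of_exact (HomologicalComplex.eval A (ComplexShape.down ℕ) n)
  have := h.mono_f
  exact ⟨h.exact.lift f hf, h.exact.lift_f f hf⟩

lemma mono_f_of_shortExact (hS : S.ShortExact) (n : ℕ) : Mono (S.f.f n) :=
  (hS.map_of_exact (HomologicalComplex.eval A (ComplexShape.down ℕ) n)).mono_f

lemma epi_g_of_shortExact (hS : S.ShortExact) (n : ℕ) : Epi (S.g.f n) :=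
  (hS.map_of_exact (HomologicalComplex.eval A (ComplexShape.down ℕ) n)).epi_g

/-- For a short exact sequence, the map from the mapping cone of the first map to the third
complex. -/
def coneDesc (S : ShortComplex (ChainComplex A ℕ)) : homotopyCofiber S.f ⟶ S.X₃ :=
  homotopyCofiber.desc S.f S.g (Homotopy.ofEq S.zero)

lemma inlX_coneDesc (i j : ℕ) (h : (ComplexShape.down ℕ).Rel j i) :
    homotopyCofiber.inlX S.f i j h ≫ (coneDesc S).f j = 0 :=
  homotopyCofiber.inlX_desc_f _ _ _ _ _ _

lemma inrX_coneDesc (i : ℕ) :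
    homotopyCofiber.inrX S.f i ≫ (coneDesc S).f i = S.g.f i :=
  homotopyCofiber.inrX_desc_f _ _ _ _

lemma coneDesc_f (i : ℕ) : (coneDesc S).f i = homotopyCofiber.sndX S.f i ≫ S.g.f i := by
  rcases i with _ | i
  · exact homotopyCofiber.desc_f' _ _ _ _ (by simp)
  · refine (homotopyCofiber.desc_f _ _ _ (i + 1) i (by simp)).trans ?_
    simp [Homotopy.ofEq]

lemma comp_inlX_d {T : A} {n : ℕ} (k : T ⟶ S.X₁.X n) (hk : ∀ m, k ≫ S.X₁.d n m = 0) :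
    k ≫ homotopyCofiber.inlX S.f n (n + 1) (by simp) ≫ (homotopyCofiber S.f).d (n + 1) n =
      k ≫ S.f.f n ≫ homotopyCofiber.inrX S.f n := by
  rcases n with _ | n
  · exact congrArg (k ≫ ·) (homotopyCofiber.inlX_d' S.f 1 0 (by simp) (by simp))
  · refine (congrArg (k ≫ ·)
      (homotopyCofiber.inlX_d S.f (n + 2) (n + 1) n (by simp) (by simp))).trans ?_
    have := hk n
    simp [reassoc_of% this]

lemma epi_homologyMap_coneDesc (hS : S.ShortExact) (j : ℕ) :
    Epi (homologyMap (coneDesc S) j) := by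
  have := epi_g_of_shortExact hS j
  rcases j with _ | n
  · rw [epi_homologyMap_iff_up_to_refinements _ 1 0 0 (by simp) (by simp)]
    intro T y hy
    obtain ⟨T', π, hπ, f, hf⟩ := surjective_up_to_refinements_of_epi (S.g.f 0) y
    exact ⟨T', π, hπ, f ≫ homotopyCofiber.inrX S.f 0,
      by rw [(homotopyCofiber S.f).shape 0 0 (by simp), comp_zero], 0, by
      rw [Category.assoc, inrX_coneDesc, hf, zero_comp, add_zero]⟩
  · rw [epi_homologyMap_iff_up_to_refinements _ (n + 2) (n + 1) n (by simp) (by simp)]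
    intro T y hy
    obtain ⟨T', π, hπ, f, hf⟩ := surjective_up_to_refinements_of_epi (S.g.f (n + 1)) y
    obtain ⟨k, hk⟩ := exists_lift_of_shortExact hS (f ≫ S.X₂.d (n + 1) n) (by
      rw [Category.assoc, ← S.g.comm, ← Category.assoc, ← hf, Category.assoc, hy, comp_zero])
    have hk' : ∀ m, k ≫ S.X₁.d n m = 0 := fun m => by
      have := mono_f_of_shortExact hS m
      rw [← cancel_mono (S.f.f m), Category.assoc, ← S.f.comm, reassoc_of% hk]
      simp
    refine ⟨T', π, hπ, f ≫ homotopyCofiber.inrX S.f (n + 1) -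
      k ≫ homotopyCofiber.inlX S.f n (n + 1) (by simp), ?_, 0, ?_⟩
    · have h1 : homotopyCofiber.inrX S.f (n + 1) ≫ (homotopyCofiber S.f).d (n + 1) n =
        S.X₂.d (n + 1) n ≫ homotopyCofiber.inrX S.f n := homotopyCofiber.inrX_d S.f (n + 1) n
      rw [Preadditive.sub_comp, Category.assoc, Category.assoc, comp_inlX_d k hk', h1,
        reassoc_of% hk, sub_self]
    · rw [Preadditive.sub_comp, Category.assoc, Category.assoc, inrX_coneDesc, inlX_coneDesc,
        comp_zero, zero_comp, sub_zero, add_zero, hf]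

lemma mono_homologyMap_coneDesc (hS : S.ShortExact) (j : ℕ) :
    Mono (homologyMap (coneDesc S) j) := by
  rw [mono_homologyMap_iff_up_to_refinements _ (j + 1) j _ (by simp) rfl]
  intro T x hx y hxy
  have := epi_g_of_shortExact hS (j + 1)
  obtain ⟨T', π, hπ, f, hf⟩ := surjective_up_to_refinements_of_epi (S.g.f (j + 1)) y
  have hs : (x ≫ homotopyCofiber.sndX S.f j) ≫ S.g.f j = y ≫ S.X₃.d (j + 1) j := by
    rw [Category.assoc, ← coneDesc_f, hxy]
  obtain ⟨k, hk⟩ := exists_lift_of_shortExact hS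
    (π ≫ x ≫ homotopyCofiber.sndX S.f j - f ≫ S.X₂.d (j + 1) j) (by
      rw [Preadditive.sub_comp, Category.assoc, hs, Category.assoc, ← S.g.comm,
        ← Category.assoc f, ← hf, Category.assoc, sub_self])
  refine ⟨T', π, hπ, k ≫ homotopyCofiber.inlX S.f j (j + 1) (by simp) +
    f ≫ homotopyCofiber.inrX S.f (j + 1), ?_⟩
  have hd : (homotopyCofiber S.f).d (j + 1) j = homotopyCofiber.d S.f (j + 1) j := rfl
  rw [Preadditive.add_comp, Category.assoc, Category.assoc, hd, homotopyCofiber.inrX_d]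
  rcases j with _ | j
  · refine homotopyCofiber.ext_to_X' S.f 0 (by simp) ?_
    rw [homotopyCofiber.inlX_d' S.f 1 0 (by simp) (by simp), reassoc_of% hk]
    simp
  · rw [homotopyCofiber.inlX_d S.f (j + 2) (j + 1) j (by simp) (by simp)]
    refine homotopyCofiber.ext_to_X S.f (j + 1) j (by simp) ?_ ?_
    · have := mono_f_of_shortExact hS j
      rw [← cancel_mono (S.f.f j)]
      have hx' : x ≫ homotopyCofiber.d S.f (j + 1) j = 0 := by
        have e : (ComplexShape.down ℕ).next (j + 1) = j := by simp
        rw [e] at hx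
        exact hx
      have h1 := congrArg (· ≫ homotopyCofiber.sndX S.f j) hx'
      simp only [Category.assoc, homotopyCofiber.d_sndX S.f (j + 1) j (by simp),
        zero_comp, Preadditive.comp_add] at h1
      simp [Preadditive.add_comp]
      rw [← S.f.comm, reassoc_of% hk]
      simp [eq_neg_of_add_eq_zero_left h1]
    · simp only [Preadditive.add_comp, Preadditive.comp_add, Category.assoc,
        homotopyCofiber.inlX_sndX, homotopyCofiber.inrX_sndX, comp_zero, zero_add,
        Preadditive.neg_comp, Preadditive.comp_neg, Category.comp_id, hk, neg_zero]
      simp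

lemma quasiIso_coneDesc (hS : S.ShortExact) : QuasiIso (coneDesc S) := by
  rw [quasiIso_iff]
  intro j
  rw [quasiIsoAt_iff_isIso_homologyMap]
  have := epi_homologyMap_coneDesc hS j
  have := mono_homologyMap_coneDesc hS j
  exact isIso_of_mono_of_epi _

end

end

section

/-- Nonnegatively graded chain complexes of abelian groups. -/
abbrev Ch := ChainComplex Ab.{0} ℕ

/-- The reduced free functor in each degree. -/
def degreewiseFree : Ch ⥤ Ch := freeFunctor.mapHomologicalComplex _

/-- The natural epimorphism from `degreewiseFree`. -/
def degreewiseEval : degreewiseFree ⟶ 𝟭 Ch :=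
  NatTrans.mapHomologicalComplex freeEval _ ≫ (Functor.mapHomologicalComplexIdIso _ _).hom

instance (X : Ch) (n : ℕ) : Epi ((degreewiseEval.app X).f n) := by
  have : (degreewiseEval.app X).f n = freeEval.app (X.X n) := by
    simp [degreewiseEval]; exact Category.comp_id _
  rw [this]; exact epi_freeEval _

instance (X : Ch) : Epi (degreewiseEval.app X) := HomologicalComplex.epi_of_epi_f _ inferInstance

/-- The short exact sequence of `degreewiseEval`. -/
abbrev relations (X : Ch) : ShortComplex Ch :=
  ShortComplex.mk (Limits.kernel.ι (degreewiseEval.app X)) (degreewiseEval.app X)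
    (Limits.kernel.condition _)

lemma relations_shortExact (X : Ch) : (relations X).ShortExact where
  exact := ShortComplex.exact_kernel _

/-- Functoriality of the kernel of `degreewiseEval`. -/
def relationsMap {X Y : Ch} (f : X ⟶ Y) :
    Arrow.mk (relations X).f ⟶ Arrow.mk (relations Y).f :=
  Arrow.homMk (Limits.kernel.map _ _ (degreewiseFree.map f) f (degreewiseEval.naturality f).symm)
    (degreewiseFree.map f) (by simp)

lemma exists_rel (j : ℕ) : ∃ i, (ComplexShape.down ℕ).Rel i j := ⟨j + 1, by simp⟩

open HomologicalComplex

/-- The functorial resolution: the mapping cone of `ker (degreewiseEval) → degreewiseFree`. It is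
projective in each degree, and `resolutionEval` is a quasi-isomorphism to the complex. -/
def resolution : Ch ⥤ Ch where
  obj X := homotopyCofiber (relations X).f
  map f := homotopyCofiber.mapArrowHom _ _ exists_rel (relationsMap f)
  map_id X := by
    have : relationsMap (𝟙 X) = 𝟙 _ := by
      ext <;> simp [relationsMap]
    rw [this, homotopyCofiber.mapArrowHom_id]
  map_comp {X Y Z} f g := by
    have : relationsMap (f ≫ g) = relationsMap f ≫ relationsMap g := by
      refine CommaMorphism.ext ?_ ?_
      · exact (cancel_mono (relations Z).f).1 (by simp [relationsMap])
      · simp [relationsMap]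
    rw [this, homotopyCofiber.mapArrowHom_comp]

/-- The natural quasi-isomorphism from the resolution. -/
def resolutionEval : resolution ⟶ 𝟭 Ch where
  app X := coneDesc (relations X)
  naturality X Y f := by
    refine HomologicalComplex.hom_ext _ _ fun i => ?_
    have hn : degreewiseFree.map f ≫ (relations Y).g = (relations X).g ≫ f :=
      degreewiseEval.naturality f
    have hn' := HomologicalComplex.congr_hom hn i
    change (homotopyCofiber.mapArrowHom _ _ exists_rel (relationsMap f)).f i ≫
      (coneDesc (relations Y)).f i = (coneDesc (relations X)).f i ≫ f.f i
    have h1 : homotopyCofiber.inrX (relations X).f i ≫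
        (homotopyCofiber.mapArrowHom _ _ exists_rel (relationsMap f)).f i ≫
          (coneDesc (relations Y)).f i =
        homotopyCofiber.inrX (relations X).f i ≫ (coneDesc (relations X)).f i ≫ f.f i := by
      have e1 : homotopyCofiber.inrX (relations X).f i ≫
          (homotopyCofiber.mapArrowHom _ _ exists_rel (relationsMap f)).f i =
          (degreewiseFree.map f).f i ≫ homotopyCofiber.inrX (relations Y).f i := by
        rw [homotopyCofiber.mapArrowHom, homotopyCofiber.inrX_desc_f]; rfl
      rw [reassoc_of% e1, inrX_coneDesc (S := relations Y), ← Category.assoc,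
        inrX_coneDesc (S := relations X)]
      exact hn'
    rcases i with _ | i
    · exact homotopyCofiber.ext_from_X' (relations X).f 0 (by simp) h1
    · refine homotopyCofiber.ext_from_X (relations X).f i (i + 1) (by simp) ?_ h1
      have e1 : homotopyCofiber.inlX (relations X).f i (i + 1) (by simp) ≫
          (homotopyCofiber.mapArrowHom _ _ exists_rel (relationsMap f)).f (i + 1) =
          (relationsMap f).left.f i ≫
            homotopyCofiber.inlX (relations Y).f i (i + 1) (by simp) := by
        rw [homotopyCofiber.mapArrowHom, homotopyCofiber.inlX_desc_f]
        simp [homotopyCofiber.inrCompHomotopy_hom]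
      rw [reassoc_of% e1, inlX_coneDesc (S := relations Y), ← Category.assoc,
        inlX_coneDesc (S := relations X)]
      simp

instance (X : Ch) : QuasiIso (resolutionEval.app X) := quasiIso_coneDesc (relations_shortExact X)

instance (X : Ch) (n : ℕ) : Projective ((resolution.obj X).X n) := by
  have h0 : ∀ m, Mono ((relations X).f.f m) := mono_f_of_shortExact (relations_shortExact X)
  have h1 : ∀ m, Projective ((relations X).X₁.X m) := fun m =>
    @projective_of_mono _ (freeFunctor.obj (X.X m)) _ ((relations X).f.f m) (h0 m)
  have h2 : ∀ m, Projective ((relations X).X₂.X m) := fun m =>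
    inferInstanceAs (Projective (freeFunctor.obj (X.X m)))
  rcases n with _ | n
  · exact Projective.of_iso (homotopyCofiber.XIso (relations X).f 0 (by simp)).symm (h2 0)
  · exact Projective.of_iso (homotopyCofiber.XIsoBiprod (relations X).f (n+1) n (by simp)).symm
      inferInstance

end

section

open Abelian.DoldKan

/-! ### Derived categories and derived functors -/

/-- The quasi-isomorphisms of nonnegatively graded chain complexes. -/
abbrev W : MorphismProperty Ch := HomologicalComplex.quasiIso Ab.{0} (ComplexShape.down ℕ)

instance : W.HasLocalization := MorphismProperty.HasLocalization.standard W

/-- The derived category of nonnegatively graded chain complexes of abelian groups (homological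
grading; these are the objects concentrated in nonpositive cohomological degrees): the localization
of `Ch` at the quasi-isomorphisms. -/
abbrev DAb := HomologicalComplexUpToQuasiIso Ab.{0} (ComplexShape.down ℕ)

/-- The localization functor. -/
abbrev Q : Ch ⥤ DAb := HomologicalComplexUpToQuasiIso.Q

/-- The functor `N F Γ` on chain complexes: apply a functor `F` of abelian groups in each degree to
the simplicial abelian group that corresponds to a complex, and normalize. -/
def prolong (F : Ab.{0} ⥤ Ab.{0}) : Ch ⥤ Ch :=
  Γ ⋙ (SimplicialObject.whiskering _ _).obj F ⋙ N

/-- Simplicial homotopies give chain homotopies of normalized complexes. -/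
def mooreHomotopy {X Y : SimplicialObject Ab.{0}} {f g : X ⟶ Y}
    (H : SimplicialObject.Homotopy f g) : Homotopy (N.map f) (N.map g) := by
  have h : ∀ f : X ⟶ Y, (AlgebraicTopology.inclusionOfMooreComplexMap X ≫
      (AlgebraicTopology.alternatingFaceMapComplex _).map f) ≫
        AlgebraicTopology.DoldKan.PInftyToNormalizedMooreComplex Y = N.map f := fun f => by
    have hn := (AlgebraicTopology.inclusionOfMooreComplex Ab.{0}).naturality f
    refine (congrArg (· ≫ AlgebraicTopology.DoldKan.PInftyToNormalizedMooreComplex Y) hn.symm).trans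
      ?_
    refine (Category.assoc _ _ _).trans ?_
    refine (congrArg (N.map f ≫ ·)
      (AlgebraicTopology.DoldKan.splitMonoInclusionOfMooreComplexMap Y).id).trans ?_
    exact Category.comp_id _
  exact (Homotopy.ofEq (h f).symm).trans (((H.toChainHomotopy.compLeft _).compRight _).trans
    (Homotopy.ofEq (h g)))

lemma nonempty_prolongHomotopy (F : Ab.{0} ⥤ Ab.{0}) {K L : Ch} [∀ n, Projective (K.X n)]
    {u v : K ⟶ L} (H : Homotopy u v) :
    Nonempty (Homotopy ((prolong F).map u) ((prolong F).map v)) := by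
  obtain ⟨H'⟩ := nonempty_simplicialHomotopy H
  exact ⟨mooreHomotopy (H'.whiskerRight F)⟩

lemma quasiIso_prolong_map (F : Ab.{0} ⥤ Ab.{0}) {K L : Ch} [∀ n, Projective (K.X n)]
    [∀ n, Projective (L.X n)] (f : K ⟶ L) [QuasiIso f] : QuasiIso ((prolong F).map f) := by
  obtain ⟨e, rfl⟩ := (ChainComplex.quasiIso_iff_of_projective f).1 inferInstance
  obtain ⟨H1⟩ := nonempty_prolongHomotopy F e.homotopyHomInvId
  obtain ⟨H2⟩ := nonempty_prolongHomotopy F e.homotopyInvHomId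
  let e' : HomotopyEquiv ((prolong F).obj K) ((prolong F).obj L) :=
    { hom := (prolong F).map e.hom
      inv := (prolong F).map e.inv
      homotopyHomInvId := (Homotopy.ofEq (by simp)).trans (H1.trans (Homotopy.ofEq (by simp)))
      homotopyInvHomId := (Homotopy.ofEq (by simp)).trans (H2.trans (Homotopy.ofEq (by simp))) }
  exact homotopyEquivalences_le_quasiIso _ _ _ ⟨e', rfl⟩

instance quasiIso_resolution_map {X Y : Ch} (f : X ⟶ Y) [QuasiIso f] :
    QuasiIso (resolution.map f) := by
  have h := resolutionEval.naturality f
  have : QuasiIso (resolution.map f ≫ resolutionEval.app Y) := by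
    rw [h]
    exact inferInstanceAs (QuasiIso (resolutionEval.app X ≫ f))
  exact quasiIso_of_comp_right _ (resolutionEval.app Y)

/-- `T` preserves quasi-isomorphisms between complexes that are projective in each degree. -/
structure LeftDerivable (T : Ch ⥤ Ch) : Prop where
  quasiIso_map : ∀ {K L : Ch} [∀ n, Projective (K.X n)] [∀ n, Projective (L.X n)] (f : K ⟶ L)
    [QuasiIso f], QuasiIso (T.map f)

lemma LeftDerivable.isInvertedBy {T : Ch ⥤ Ch} (hT : LeftDerivable T) :
    W.IsInvertedBy (resolution ⋙ T ⋙ Q) := fun X Y f hf => by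
  have : QuasiIso f := hf
  have := hT.quasiIso_map (resolution.map f)
  exact Localization.inverts Q W _ this

/-- The left derived functor of `T` on the derived category: the value of `T` on a projective
resolution. -/
def LeftDerivable.derived {T : Ch ⥤ Ch} (hT : LeftDerivable T) : DAb ⥤ DAb :=
  Localization.lift (resolution ⋙ T ⋙ Q) hT.isInvertedBy Q

instance {T : Ch ⥤ Ch} (hT : LeftDerivable T) :
    Localization.Lifting Q W (resolution ⋙ T ⋙ Q) hT.derived :=
  inferInstanceAs (Localization.Lifting Q W _ (Localization.lift _ hT.isInvertedBy Q))

/-- The natural transformation of left derived functors that is induced by `α`. -/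
def derivedMap {S T : Ch ⥤ Ch} (hS : LeftDerivable S) (hT : LeftDerivable T) (α : S ⟶ T) :
    hS.derived ⟶ hT.derived :=
  Localization.liftNatTrans Q W (resolution ⋙ S ⋙ Q) (resolution ⋙ T ⋙ Q) _ _
    (Functor.whiskerLeft resolution (Functor.whiskerRight α Q))

lemma leftDerivable_prolong (F : Ab.{0} ⥤ Ab.{0}) : LeftDerivable (prolong F) :=
  ⟨fun f => quasiIso_prolong_map F f⟩

lemma leftDerivable_map (T : Ab.{0} ⥤ Ab.{0}) [T.Additive] :
    LeftDerivable (T.mapHomologicalComplex (ComplexShape.down ℕ)) where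
  quasiIso_map f _ := by
    obtain ⟨e, rfl⟩ := (ChainComplex.quasiIso_iff_of_projective f).1 inferInstance
    exact homotopyEquivalences_le_quasiIso _ _ _ ⟨T.mapHomotopyEquiv e, rfl⟩

/-- Functoriality of `prolong` in the functor of abelian groups. -/
def prolongMap {F G : Ab.{0} ⥤ Ab.{0}} (α : F ⟶ G) : prolong F ⟶ prolong G :=
  Functor.whiskerLeft Γ (Functor.whiskerRight ((SimplicialObject.whiskering _ _).map α) N)

/-- The natural projection from the alternating face map complex to the normalized one. -/
def mooreRetraction : AlgebraicTopology.alternatingFaceMapComplex Ab.{0} ⟶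
    AlgebraicTopology.normalizedMooreComplex Ab.{0} where
  app X := AlgebraicTopology.DoldKan.PInftyToNormalizedMooreComplex X
  naturality _ _ f := AlgebraicTopology.DoldKan.PInftyToNormalizedMooreComplex_naturality f

/-- For an additive functor `T`, the natural comparison from `N T Γ` to `T` in each degree: the
normalized complex of `T (Γ P)` is included into the alternating face map complex, which is `T`
applied to the alternating face map complex of `Γ P`, and this is projected to `T (N Γ P) ≅ T P`. -/
def prolongToMap (T : Ab.{0} ⥤ Ab.{0}) [T.Additive] :
    prolong T ⟶ T.mapHomologicalComplex (ComplexShape.down ℕ) :=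
  (Functor.whiskerLeft (Γ ⋙ (SimplicialObject.whiskering _ _).obj T)
      (AlgebraicTopology.inclusionOfMooreComplex Ab.{0}) :
    _ ⟶ Γ ⋙ (SimplicialObject.whiskering _ _).obj T ⋙
      AlgebraicTopology.alternatingFaceMapComplex Ab.{0}) ≫
  Functor.whiskerLeft Γ (eqToHom (AlgebraicTopology.map_alternatingFaceMapComplex T).symm) ≫
  Functor.whiskerLeft Γ (Functor.whiskerRight mooreRetraction (T.mapHomologicalComplex _)) ≫
  (Functor.whiskerRight counit.hom (T.mapHomologicalComplex _) :
    (Γ ⋙ N) ⋙ T.mapHomologicalComplex _ ⟶ T.mapHomologicalComplex _)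

/-- The shift `C ↦ C[1]`, with `C[1]ₙ₊₁ = Cₙ` and `C[1]₀ = 0`. The usual sign of the differential is
omitted; the two conventions are naturally isomorphic via the signs `(-1)ⁿ`. -/
def shiftComplex : Ch ⥤ Ch := (ComplexShape.embeddingDown'Add 1 1).extendFunctor Ab.{0}

lemma isInvertedBy_shiftComplex : W.IsInvertedBy (shiftComplex ⋙ Q) := fun X Y f hf => by
  have : QuasiIso f := hf
  have : QuasiIso (shiftComplex.map f) :=
    (HomologicalComplex.quasiIso_extendMap_iff _ _).2 ‹_›
  exact Localization.inverts Q W _ this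

/-- The shift `C ↦ C[1]` on the derived category. -/
def shift : DAb ⥤ DAb := Localization.lift (shiftComplex ⋙ Q) isInvertedBy_shiftComplex Q

/-- The derived functor `LF` of a functor `F` of abelian groups, not necessarily additive. -/
def leftDerived (F : Ab.{0} ⥤ Ab.{0}) : DAb ⥤ DAb := (leftDerivable_prolong F).derived

/-- The functor `C ↦ C ⊗ᴸ ℤ/2`. -/
def derivedTensorZModTwo : DAb ⥤ DAb := (leftDerivable_map tensorZModTwo).derived

/-- The natural transformation `LSP² → LΓ₂`. -/
def LSP2ToLGamma2 : leftDerived SP2 ⟶ leftDerived Gamma2 :=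
  derivedMap _ _ (prolongMap SP2ToGamma2)

/-- The natural transformation `LΓ₂ → - ⊗ᴸ ℤ/2`. -/
def LGamma2ToTensor : leftDerived Gamma2 ⟶ derivedTensorZModTwo :=
  derivedMap _ _ (prolongMap Gamma2ToTensor ≫ prolongToMap tensorZModTwo)

/-- The functor `C ↦ LSP²(C[1])`. -/
def suspendedLSP2 : DAb ⥤ DAb := shift ⋙ leftDerived SP2

/-- The functor `C ↦ LΓ₂(C[1])`. -/
def suspendedLGamma2 : DAb ⥤ DAb := shift ⋙ leftDerived Gamma2

/-- The functor `C ↦ C[1] ⊗ᴸ ℤ/2 = (C ⊗ᴸ ℤ/2)[1]`. -/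
def suspendedTensor : DAb ⥤ DAb := shift ⋙ derivedTensorZModTwo

/-- The natural map `LSP²(C[1]) → LΓ₂(C[1])`. -/
def seqLeft : suspendedLSP2 ⟶ suspendedLGamma2 := Functor.whiskerLeft shift LSP2ToLGamma2

/-- The natural map `LΓ₂(C[1]) → C ⊗ᴸ ℤ/2[1]`. -/
def seqRight : suspendedLGamma2 ⟶ suspendedTensor := Functor.whiskerLeft shift LGamma2ToTensor

end

end DerAb

end

/-! Splitting is already contradicted on `ℤ` and `ℤ²`, placed in degree zero, and the maps `intInl`,
`intInr` and `intInl + intInr` between them. In second homology with coefficients in `ℤ/2`, the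
right-hand functor is additive in `A`, the left-hand one vanishes at `ℤ`, and the middle one is
genuinely quadratic.

For `A` free of finite rank, `A[1]` is the normalized complex of `K(A, 1)`, which is projective in
each degree, so `LF(A[1])` is the normalized complex of `F(K(A, 1))`
(`isIso_leftDerivedComparison_app`). For quadratic `F` this complex vanishes above degree two
(`IsQuadratic.moore_eq_zero`). For `Γ₂` it is `A ⊗ A → Γ₂(A)`, `a ⊗ b ↦ -γ₁(a) γ₁(b)`, in degrees
two and one. Since `γ₁(a)² = 2 γ₂(a)`, the pair `(a ⊗ a, γ₂(a))` is a cycle with coefficients in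
`ℤ/2`. Its class `gammaClass a` is natural in `a` but not additive: the deviation on `a`, `b` is the
class of `(a ⊗ b + b ⊗ a, γ₁(a) γ₁(b))`. For the basis of `ℤ²` this is nonzero
(`gammaClass_add_sub_ne_zero`), and it comes from the symmetric square
(`exists_gammaClass_add_sub`).

Over `ℤ` the complex for `SP²` is acyclic (`exactAt_SP2_int`), while for `Γ₂` the only possible
nonzero class is `gammaClass 1` (`modTwoH_Gamma2_int`).

A transformation from the right-hand functor to the middle one that is injective at `ℤ` in this
homology must hit `gammaClass 1`, and additivity of its source then makes the deviation vanish, a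
contradiction (`false_of_injective`). A section is such a transformation. So is the second inclusion
of a direct sum decomposition, because the other summand is initial at `ℤ`. A retraction kills
`gammaClass 1`, since its target vanishes at `ℤ`, hence kills the deviation by naturality. But the
deviation is the image of some `w` under the left-hand map, so `w`, and with it the deviation, is
zero (`false_of_retraction`). -/

noncomputable section

namespace DerAb

/-! ### Quasi-isomorphisms of complexes of abelian groups in terms of elements. -/

section ElementwiseChase

lemma hom_comp_apply {A B C : Ab.{0}} (f : A ⟶ B) (g : B ⟶ C) (x : A) :
    (f ≫ g).hom x = g.hom (f.hom x) := rfl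

lemma hom_eq_of_comp_eq {A B C D : Ab.{0}} {f : A ⟶ B} {g : B ⟶ D} {f' : A ⟶ C} {g' : C ⟶ D}
    (h : f ≫ g = f' ≫ g') (x : A) : g.hom (f.hom x) = g'.hom (f'.hom x) :=
  congrArg (fun t : A ⟶ D => t.hom x) h

lemma asHom_hom_apply_one {G : Ab.{0}} (g : G) : (AddCommGrpCat.asHom g).hom (1 : ℤ) = g :=
  one_zsmul g

lemma asHom_comp_eq {G H : Ab.{0}} {f : G ⟶ H} {g : G} {h : H} (e : f.hom g = h) :
    AddCommGrpCat.asHom g ≫ f = AddCommGrpCat.asHom h :=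
  AddCommGrpCat.int_hom_ext _ _ (by
    change f.hom ((AddCommGrpCat.asHom g).hom (1 : ℤ)) = (AddCommGrpCat.asHom h).hom (1 : ℤ)
    rw [asHom_hom_apply_one, asHom_hom_apply_one, e])

lemma asHom_zero {H : Ab.{0}} : AddCommGrpCat.asHom (0 : H) = 0 :=
  AddCommGrpCat.int_hom_ext _ _ (asHom_hom_apply_one _)

variable {X Y : Ch} (f : X ⟶ Y)

/-- A quasi-isomorphism detects boundaries. -/
lemma exists_boundary_of_quasiIso [QuasiIso f] {i j k : ℕ} (hi : (ComplexShape.down ℕ).prev j = i)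
    (hk : (ComplexShape.down ℕ).next j = k) (x : X.X j) (hx : (X.d j k).hom x = 0)
    (y : Y.X i) (hy : (f.f j).hom x = (Y.d i j).hom y) : ∃ z, x = (X.d i j).hom z := by
  have : Mono (HomologicalComplex.homologyMap f j) := inferInstance
  -- An element is a morphism from `ℤ`. The bounding chain exists only after pulling back along an
  -- epimorphism `π : T ⟶ ℤ`; a preimage of `1` under `π` turns it back into an element.
  obtain ⟨T, π, hπ, z, hz⟩ := (HomologicalComplex.mono_homologyMap_iff_up_to_refinements f i j k
    hi hk).1 this (AddCommGrpCat.asHom x) (by rw [asHom_comp_eq hx, asHom_zero])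
      (AddCommGrpCat.asHom y) (by rw [asHom_comp_eq hy, asHom_comp_eq rfl])
  obtain ⟨t, ht⟩ := (AddCommGrpCat.epi_iff_surjective π).1 hπ (1 : ℤ)
  refine ⟨z.hom t, ?_⟩
  rw [← hom_eq_of_comp_eq hz]
  refine Eq.trans ?_ (congrArg (AddCommGrpCat.asHom x).hom ht.symm)
  exact (asHom_hom_apply_one _).symm

/-- A quasi-isomorphism is surjective on cycles up to boundaries. -/
lemma exists_cycle_of_quasiIso [QuasiIso f] {i j k : ℕ} (hi : (ComplexShape.down ℕ).prev j = i)
    (hk : (ComplexShape.down ℕ).next j = k) (y : Y.X j) (hy : (Y.d j k).hom y = 0) :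
    ∃ x z, (X.d j k).hom x = 0 ∧ y = (f.f j).hom x + (Y.d i j).hom z := by
  have : Epi (HomologicalComplex.homologyMap f j) := inferInstance
  obtain ⟨T, π, hπ, x, hx, z, hz⟩ := (HomologicalComplex.epi_homologyMap_iff_up_to_refinements f
    i j k hi hk).1 this (AddCommGrpCat.asHom y) (by rw [asHom_comp_eq hy, asHom_zero])
  obtain ⟨t, ht⟩ := (AddCommGrpCat.epi_iff_surjective π).1 hπ (1 : ℤ)
  refine ⟨x.hom t, z.hom t, congrArg (fun s : T ⟶ _ => s.hom t) hx, ?_⟩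
  refine Eq.trans ?_ (congrArg (fun s : T ⟶ _ => s.hom t) hz)
  refine Eq.trans ?_ (congrArg (AddCommGrpCat.asHom y).hom ht.symm)
  exact (asHom_hom_apply_one _).symm

end ElementwiseChase

section ModTwoHomology

/-! ### The second homology with coefficients in `ℤ/2` -/

/-- The cycles of degree two of `X ⊗ (ℤ → ℤ)`, where `ℤ → ℤ` is multiplication by two. -/
def modTwoCycles (X : Ch) : AddSubgroup (X.X 2 × X.X 1) where
  carrier := {p | (X.d 2 1).hom p.1 + 2 • p.2 = 0 ∧ (X.d 1 0).hom p.2 = 0}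
  zero_mem' := by simp
  add_mem' {p q} hp hq := by
    refine ⟨?_, by simp [hp.2, hq.2]⟩
    have := congrArg₂ (· + ·) hp.1 hq.1
    simp only [add_zero] at this
    rw [← this, Prod.fst_add, Prod.snd_add, map_add, nsmul_add]
    abel
  neg_mem' {p} hp := by
    refine ⟨?_, by simp [hp.2]⟩
    have := congrArg (- ·) hp.1
    simp only [neg_zero] at this
    rw [← this, Prod.fst_neg, Prod.snd_neg, map_neg, smul_neg]
    abel

/-- The boundaries of degree two of `X ⊗ (ℤ → ℤ)`. -/
def modTwoBoundaries (X : Ch) : AddSubgroup (X.X 2 × X.X 1) where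
  carrier := {p | ∃ (w : X.X 3) (v : X.X 2),
    p = ((X.d 3 2).hom w + 2 • v, - (X.d 2 1).hom v)}
  zero_mem' := ⟨0, 0, by simp; rfl⟩
  add_mem' := by
    rintro _ _ ⟨w, v, rfl⟩ ⟨w', v', rfl⟩
    refine ⟨w + w', v + v', Prod.ext ?_ ?_⟩
    · simp only [map_add, nsmul_add, Prod.fst_add]; abel
    · simp only [map_add, Prod.snd_add]; abel
  neg_mem' := by
    rintro _ ⟨w, v, rfl⟩
    refine ⟨-w, -v, Prod.ext ?_ ?_⟩
    · simp only [map_neg, smul_neg, Prod.fst_neg]; abel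
    · simp only [map_neg, Prod.snd_neg]

/-- The second homology group with coefficients in `ℤ/2`. -/
abbrev ModTwoH (X : Ch) : Type := modTwoCycles X ⧸ (modTwoBoundaries X).addSubgroupOf (modTwoCycles X)

variable {X Y : Ch}

lemma hom_comm (f : X ⟶ Y) (i j : ℕ) (x : X.X i) :
    (f.f j).hom ((X.d i j).hom x) = (Y.d i j).hom ((f.f i).hom x) :=
  (hom_eq_of_comp_eq (f.comm i j) x).symm

/-- Functoriality of `modTwoCycles`. -/
def modTwoCyclesMap (f : X ⟶ Y) : modTwoCycles X →+ modTwoCycles Y :=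
  (((f.f 2).hom.prodMap (f.f 1).hom).comp (modTwoCycles X).subtype).codRestrict _ (by
    rintro ⟨⟨x, y⟩, h1, h2⟩
    refine ⟨?_, ?_⟩
    · have := congrArg (f.f 1).hom h1
      rwa [map_add, map_nsmul, map_zero, hom_comm] at this
    · have := congrArg (f.f 0).hom h2
      rwa [map_zero, hom_comm] at this)

/-- Functoriality of `ModTwoH`. -/
def modTwoHMap (f : X ⟶ Y) : ModTwoH X →+ ModTwoH Y :=
  QuotientAddGroup.map _ _ (modTwoCyclesMap f) (by
    rintro ⟨p, hp⟩ ⟨w, v, h⟩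
    refine ⟨(f.f 3).hom w, (f.f 2).hom v, ?_⟩
    have h : p = _ := h
    subst h
    refine Prod.ext ?_ ?_
    · change (f.f 2).hom ((X.d 3 2).hom w + 2 • v) = _
      rw [map_add, map_nsmul, hom_comm]
    · change (f.f 1).hom (- (X.d 2 1).hom v) = _
      rw [map_neg, hom_comm])

/-- The class of a cycle. -/
def modTwoClass (x : X.X 2) (y : X.X 1) (h : (X.d 2 1).hom x + 2 • y = 0)
    (h' : (X.d 1 0).hom y = 0) : ModTwoH X := QuotientAddGroup.mk ⟨(x, y), h, h'⟩

lemma modTwoH_cases (z : ModTwoH X) : ∃ x y h h', z = modTwoClass x y h h' := by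
  obtain ⟨⟨⟨x, y⟩, h, h'⟩, rfl⟩ := QuotientAddGroup.mk_surjective z
  exact ⟨x, y, h, h', rfl⟩

lemma modTwoClass_eq_zero_iff {x : X.X 2} {y : X.X 1} {h h'} :
    modTwoClass x y h h' = 0 ↔
      ∃ w v, x = (X.d 3 2).hom w + 2 • v ∧ y = - (X.d 2 1).hom v := by
  refine (QuotientAddGroup.eq_zero_iff _).trans ?_
  exact exists_congr fun w => exists_congr fun v => Prod.ext_iff

lemma modTwoClass_sub {x x' : X.X 2} {y y' : X.X 1} {h h' k k'} :
    modTwoClass x y h h' - modTwoClass x' y' k k' = modTwoClass (x - x') (y - y')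
      (by rw [map_sub, nsmul_sub, sub_add_sub_comm, h, k, sub_zero])
      (by rw [map_sub, h', k', sub_zero]) := rfl

lemma modTwoHMap_class (f : X ⟶ Y) {x : X.X 2} {y : X.X 1} {h h'} :
    modTwoHMap f (modTwoClass x y h h') = modTwoClass ((f.f 2).hom x) ((f.f 1).hom y)
      (by rw [← hom_comm, ← map_nsmul, ← map_add, h, map_zero])
      (by rw [← hom_comm, h', map_zero]) := rfl

lemma modTwoClass_congr {x x' : X.X 2} {y y' : X.X 1} {h h' k k'} (e : x = x') (e' : y = y') :
    modTwoClass x y h h' = modTwoClass x' y' k k' := by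
  subst e; subst e'; rfl

/-- `ModTwoH` is an extension of the 2-torsion of `H₁` by `H₂` modulo 2, and the five lemma applies.
It is carried out here by a chase; the result lets `ModTwoH` descend to the derived category. -/
lemma bijective_modTwoHMap (f : X ⟶ Y) [QuasiIso f] : Function.Bijective (modTwoHMap f) := by
  constructor
  · rw [injective_iff_map_eq_zero]
    intro z hz
    obtain ⟨x, y, h, h', rfl⟩ := modTwoH_cases z
    rw [modTwoHMap_class, modTwoClass_eq_zero_iff] at hz
    obtain ⟨w, v, hx, hy⟩ := hz
    obtain ⟨v₁, hv₁⟩ := exists_boundary_of_quasiIso f (i := 2) (j := 1) (k := 0) (by simp)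
      (by simp) y h' (-v) (by rw [map_neg, hy])
    -- The chain `v₁` bounds `y` but need not lie over `-v`. The cycle `v + f v₁` measures the
    -- difference; replacing it by a cycle `v₂` of `X` makes `v₂ - v₁` a lift of `v` up to the
    -- boundary of `t`.
    obtain ⟨v₂, t, hv₂, ht⟩ := exists_cycle_of_quasiIso f (i := 3) (j := 2) (k := 1) (by simp)
      (by simp) (v + (f.f 2).hom v₁) (by
        rw [map_add, ← hom_comm, ← hv₁, hy, add_neg_cancel])
    obtain ⟨s, hs⟩ := exists_boundary_of_quasiIso f (i := 3) (j := 2) (k := 1) (by simp)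
      (by simp) (x - 2 • (v₂ - v₁)) (by
        rw [map_sub, map_nsmul, map_sub, hv₂, ← hv₁, zero_sub, smul_neg, sub_neg_eq_add, h])
        (w + 2 • t) (by
        have e : v = (f.f 2).hom v₂ + (Y.d 3 2).hom t - (f.f 2).hom v₁ := by rw [← ht]; abel
        rw [map_sub, hx, map_nsmul, map_sub, map_add, map_nsmul, e]
        simp only [nsmul_add, nsmul_sub]
        abel)
    refine modTwoClass_eq_zero_iff.2 ⟨s, v₂ - v₁, ?_, ?_⟩
    · rw [← hs]; abel
    · rw [map_sub, hv₂, ← hv₁]; abel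
  · intro z
    obtain ⟨x, y, h, h', rfl⟩ := modTwoH_cases z
    obtain ⟨y₁, v, hy₁, hv⟩ := exists_cycle_of_quasiIso f (i := 2) (j := 1) (k := 0) (by simp)
      (by simp) y h'
    -- As `2 • y` is the boundary of `-x`, the image of `2 • y₁` bounds in `Y`, so `2 • y₁` bounds
    -- in `X`. The chain `-x₀` is then a first approximation to the degree-two component of the
    -- lift, corrected below by the cycle `x₁`.
    obtain ⟨x₀, hx₀⟩ := exists_boundary_of_quasiIso f (i := 2) (j := 1) (k := 0) (by simp)
      (by simp) (2 • y₁) (by rw [map_nsmul, hy₁, nsmul_zero]) (-(x + 2 • v)) (by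
        rw [map_nsmul, map_neg, map_add, map_nsmul, eq_neg_iff_add_eq_zero, ← h, hv, nsmul_add]
        abel)
    obtain ⟨x₁, w, hx₁, hw⟩ := exists_cycle_of_quasiIso f (i := 3) (j := 2) (k := 1) (by simp)
      (by simp) (x + 2 • v + (f.f 2).hom x₀) (by
        rw [map_add, map_add, map_nsmul, ← hom_comm, ← hx₀, map_nsmul, ← h, hv, nsmul_add]
        abel)
    refine ⟨modTwoClass (x₁ - x₀) y₁ (by rw [map_sub, hx₁, ← hx₀]; abel) hy₁, ?_⟩
    rw [modTwoHMap_class, ← sub_eq_zero, modTwoClass_sub, modTwoClass_eq_zero_iff]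
    refine ⟨-w, v, ?_, ?_⟩
    · have e : x = (f.f 2).hom x₁ + (Y.d 3 2).hom w - 2 • v - (f.f 2).hom x₀ := by
        rw [← hw]; abel
      rw [map_sub, map_neg, e]; abel
    · rw [hv]; abel

/-- The functor `ModTwoH` on chain complexes. -/
def modTwoHomology : Ch ⥤ Ab.{0} where
  obj X := AddCommGrpCat.of (ModTwoH X)
  map f := AddCommGrpCat.ofHom (modTwoHMap f)
  map_id X := by
    refine AddCommGrpCat.hom_ext (AddMonoidHom.ext fun z => ?_)
    obtain ⟨x, y, h, h', rfl⟩ := modTwoH_cases z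
    rfl
  map_comp f g := by
    refine AddCommGrpCat.hom_ext (AddMonoidHom.ext fun z => ?_)
    obtain ⟨x, y, h, h', rfl⟩ := modTwoH_cases z
    rfl

instance : modTwoHomology.Additive where
  map_add {X Y f g} := by
    refine AddCommGrpCat.hom_ext (AddMonoidHom.ext fun z => ?_)
    obtain ⟨x, y, h, h', rfl⟩ := modTwoH_cases z
    rfl

lemma isInvertedBy_modTwoHomology : W.IsInvertedBy modTwoHomology := fun X Y f hf => by
  have : QuasiIso f := hf
  have h := bijective_modTwoHMap f
  have h1 : Mono (modTwoHomology.map f) := (AddCommGrpCat.mono_iff_injective _).2 h.1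
  have h2 : Epi (modTwoHomology.map f) := (AddCommGrpCat.epi_iff_surjective _).2 h.2
  exact isIso_of_mono_of_epi _

/-- The second homology with coefficients in `ℤ/2` on the derived category. -/
def derivedModTwoHomology : DAb ⥤ Ab.{0} :=
  Localization.lift modTwoHomology isInvertedBy_modTwoHomology Q

/-- The values of `derivedModTwoHomology` on complexes. -/
def derivedModTwoHomologyFac : Q ⋙ derivedModTwoHomology ≅ modTwoHomology :=
  Localization.fac _ _ _

end ModTwoHomology

section Moore

open Abelian.DoldKan Opposite Simplicial

/-! ### The normalized complex in terms of elements -/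

variable (Y : SimplicialObject Ab.{0})

/-- The inclusion of the normalized complex. -/
def mooreIncl (n : ℕ) : (N.obj Y).X n ⟶ Y.obj (op ⦋n⦌) :=
  (AlgebraicTopology.NormalizedMooreComplex.objX Y n).arrow

instance (n : ℕ) : Mono (mooreIncl Y n) :=
  inferInstanceAs (Mono (Subobject.arrow _))

variable {Y}

lemma mooreIncl_injective {n : ℕ} : Function.Injective (mooreIncl Y n).hom :=
  (AddCommGrpCat.mono_iff_injective _).1 inferInstance

lemma δ_mooreIncl {n : ℕ} (i : Fin (n + 1)) (x : (N.obj Y).X (n + 1)) :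
    (Y.δ i.succ).hom ((mooreIncl Y (n + 1)).hom x) = 0 :=
  congrArg (fun t : (N.obj Y).X (n + 1) ⟶ Y.obj (op ⦋n⦌) => t.hom x)
    (show mooreIncl Y (n + 1) ≫ Y.δ i.succ = 0 from
      AlgebraicTopology.DoldKan.HigherFacesVanish.inclusionOfMooreComplexMap (X := Y) n i
        (by omega))

/-- The normalized subobject is the intersection of the kernels of the faces of positive index, and
the element is tested as a morphism from `ℤ`. -/
lemma exists_mooreIncl_eq {n : ℕ} (y : Y.obj (op ⦋n + 1⦌))
    (hy : ∀ i : Fin (n + 1), (Y.δ i.succ).hom y = 0) : ∃ x, (mooreIncl Y (n + 1)).hom x = y := by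
  have hf : (AlgebraicTopology.NormalizedMooreComplex.objX Y (n + 1)).Factors
      (AddCommGrpCat.asHom y) := by
    refine (Subobject.finset_inf_factors _).2 fun i _ => ?_
    exact Limits.kernelSubobject_factors _ _ (by rw [asHom_comp_eq (hy i), asHom_zero])
  refine ⟨(Subobject.factorThru _ _ hf).hom (1 : ℤ), ?_⟩
  have := congrArg (fun t : AddCommGrpCat.of ℤ ⟶ Y.obj (op ⦋n + 1⦌) => t.hom (1 : ℤ))
    (Subobject.factorThru_arrow _ _ hf)
  exact this.trans (asHom_hom_apply_one y)

lemma mooreIncl_d {n : ℕ} (x : (N.obj Y).X (n + 1)) :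
    (mooreIncl Y n).hom (((N.obj Y).d (n + 1) n).hom x) =
      (Y.δ 0).hom ((mooreIncl Y (n + 1)).hom x) := by
  have h : (N.obj Y).d (n + 1) n ≫ mooreIncl Y n = mooreIncl Y (n + 1) ≫ Y.δ 0 := by
    refine (congrArg (· ≫ mooreIncl Y n)
      (AlgebraicTopology.normalizedMooreComplex_objD Y n)).trans ?_
    -- The normalized group in degree zero is `⊤`, and the differential into it is defined with the
    -- inverse of the arrow of `⊤`, so this case is separate.
    cases n with
    | zero =>
      refine (Category.assoc _ _ _).trans ?_
      refine congrArg (mooreIncl Y 1 ≫ ·) ?_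
      refine (Category.assoc _ _ _).trans ?_
      refine (congrArg (Y.δ 0 ≫ ·) (IsIso.inv_hom_id (⊤ : Subobject (Y.obj (op ⦋0⦌))).arrow)).trans ?_
      exact Category.comp_id _
    | succ n =>
      dsimp only [AlgebraicTopology.NormalizedMooreComplex.objD]
      exact Subobject.factorThru_arrow _ _ _
  exact hom_eq_of_comp_eq h x

lemma mooreIncl_map {Z : SimplicialObject Ab.{0}} (f : Y ⟶ Z) (n : ℕ) (x : (N.obj Y).X n) :
    (mooreIncl Z n).hom (((N.map f).f n).hom x) = (f.app (op ⦋n⦌)).hom ((mooreIncl Y n).hom x) :=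
  hom_eq_of_comp_eq (show (N.map f).f n ≫ mooreIncl Z n = mooreIncl Y n ≫ f.app (op ⦋n⦌) from
    HomologicalComplex.congr_hom ((AlgebraicTopology.inclusionOfMooreComplex Ab.{0}).naturality f) n) x

end Moore

section Bar

open Abelian.DoldKan Opposite Simplicial

/-! ### The simplicial abelian group `K(A, 1)` -/

/-- The functions on `{0, …, n}` with values in `A` that vanish at `0`. -/
def pointedFun (A : Type) [AddCommGroup A] (n : ℕ) : AddSubgroup (Fin (n + 1) → A) where
  carrier := {f | f 0 = 0}
  zero_mem' := rfl
  add_mem' {f g} hf hg := by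
    change f 0 + g 0 = 0
    rw [show f 0 = 0 from hf, show g 0 = 0 from hg, add_zero]
  neg_mem' {f} hf := by
    change - f 0 = 0
    rw [show f 0 = 0 from hf, neg_zero]

section
variable {A B : Type} [AddCommGroup A] [AddCommGroup B]

@[ext] lemma pointedFun_ext {n : ℕ} {f g : pointedFun A n} (h : ∀ j : Fin n, f.1 j.succ = g.1 j.succ) :
    f = g := by
  refine Subtype.ext (funext fun j => ?_)
  induction j using Fin.cases with
  | zero => exact (show f.1 0 = 0 from f.2).trans (show g.1 0 = 0 from g.2).symm
  | succ j => exact h j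

/-- Pull back along a map of simplices and normalize. -/
def pointedFunPull {m n : ℕ} (θ : Fin (m + 1) → Fin (n + 1)) : pointedFun A n →+ pointedFun A m where
  toFun f := ⟨fun j => f.1 (θ j) - f.1 (θ 0), sub_self _⟩
  map_zero' := Subtype.ext (funext fun _ => sub_self _)
  map_add' f _ := Subtype.ext (funext fun j => add_sub_add_comm (f.1 (θ j)) _ _ _)

/-- Apply a homomorphism to the values. -/
def pointedFunPush {n : ℕ} (φ : A →+ B) : pointedFun A n →+ pointedFun B n where
  toFun f := ⟨fun j => φ (f.1 j), (congrArg φ f.2).trans φ.map_zero⟩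
  map_zero' := Subtype.ext (funext fun _ => φ.map_zero)
  map_add' _ _ := Subtype.ext (funext fun _ => φ.map_add _ _)

end

/-- The simplicial abelian group `K(A, 1)`. -/
def barObj (A : Ab.{0}) : SimplicialObject Ab.{0} where
  obj a := AddCommGrpCat.of (pointedFun A a.unop.len)
  map θ := AddCommGrpCat.ofHom (pointedFunPull θ.unop.toOrderHom)
  map_id a := by
    refine AddCommGrpCat.hom_ext (AddMonoidHom.ext fun f => Subtype.ext (funext fun j => ?_))
    exact (congrArg (f.1 j - ·) (show f.1 0 = 0 from f.2)).trans (sub_zero _)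
  map_comp θ η := by
    refine AddCommGrpCat.hom_ext (AddMonoidHom.ext fun f => Subtype.ext (funext fun j => ?_))
    exact (sub_sub_sub_cancel_right _ _ _).symm

/-- The functor `A ↦ K(A, 1)`. -/
def bar : Ab.{0} ⥤ SimplicialObject Ab.{0} where
  obj := barObj
  map φ :=
    { app a := AddCommGrpCat.ofHom (pointedFunPush φ.hom)
      naturality a b θ := by
        refine AddCommGrpCat.hom_ext (AddMonoidHom.ext fun f => Subtype.ext (funext fun j => ?_))
        exact map_sub φ.hom (f.1 _) (f.1 _) }
  map_id A := rfl
  map_comp φ ψ := rfl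

instance : bar.Additive where
  map_add := rfl

lemma bar_δ_apply {A : Ab.{0}} {n : ℕ} (i : Fin (n + 2)) (f : pointedFun A (n + 1)) (j : Fin (n + 1)) :
    (((bar.obj A).δ i).hom f).1 j = f.1 (i.succAbove j) - f.1 (i.succAbove 0) := rfl

/-- A face of positive index keeps the base vertex `0`, so no renormalization occurs; only `δ 0`
subtracts a value. -/
lemma bar_δ_succ_apply {A : Ab.{0}} {n : ℕ} (i : Fin (n + 1)) (f : pointedFun A (n + 1))
    (j : Fin (n + 1)) : (((bar.obj A).δ i.succ).hom f).1 j = f.1 (i.succ.succAbove j) := by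
  rw [bar_δ_apply, Fin.succAbove_of_castSucc_lt i.succ 0 (Fin.succ_pos i)]
  exact (congrArg (_ - ·) (show f.1 0 = 0 from f.2)).trans (sub_zero _)

/-- Evaluation of a simplex at a vertex. -/
def barEval (A : Ab.{0}) (n : ℕ) (j : Fin (n + 1)) : (bar.obj A).obj (op ⦋n⦌) ⟶ A :=
  AddCommGrpCat.ofHom ((Pi.evalAddMonoidHom _ j).comp (pointedFun A n).subtype)

/-- In degree at least two every vertex other than `0` survives in the face that omits some other
nonzero vertex, and normalized simplices vanish on that face. -/
lemma isZero_moore_bar (A : Ab.{0}) (n : ℕ) (hn : n ≠ 1) : Limits.IsZero ((N.obj (bar.obj A)).X n) := by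
  refine @AddCommGrpCat.isZero_of_subsingleton _ ⟨fun x y => mooreIncl_injective ?_⟩
  match n, hn with
  | 0, _ => exact pointedFun_ext (A := A) fun j => j.elim0
  | n + 2, _ =>
    have key : ∀ z : (N.obj (bar.obj A)).X (n + 2), (mooreIncl (bar.obj A) (n + 2)).hom z = 0 := by
      intro z
      refine pointedFun_ext (A := A) fun j => ?_
      obtain ⟨i, hi⟩ := exists_ne j
      obtain ⟨k, hk⟩ := Fin.exists_succAbove_eq (x := j.succ) (y := i.succ)
        (fun h => hi (Fin.succ_injective _ h).symm)
      have := bar_δ_succ_apply i ((mooreIncl (bar.obj A) (n + 2)).hom z) k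
      rw [δ_mooreIncl, hk] at this
      exact this.symm
    rw [key, key]

/-- The degree one part of the normalized complex of `K(A, 1)` is `A`. -/
def mooreBarEval (A : Ab.{0}) : (N.obj (bar.obj A)).X 1 ⟶ A :=
  mooreIncl (bar.obj A) 1 ≫ barEval A 1 1

instance (A : Ab.{0}) : IsIso (mooreBarEval A) := by
  have h1 : Mono (mooreBarEval A) := (AddCommGrpCat.mono_iff_injective _).2 fun x y h =>
    mooreIncl_injective (pointedFun_ext (A := A) fun j => by
      obtain rfl : j = 0 := Subsingleton.elim _ _
      exact h)
  have h2 : Epi (mooreBarEval A) := (AddCommGrpCat.epi_iff_surjective _).2 fun a => by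
    obtain ⟨x, hx⟩ := exists_mooreIncl_eq (Y := bar.obj A) (n := 0)
      (⟨fun j => if j = 1 then a else 0, rfl⟩ : pointedFun A 1) (fun i => by
        refine pointedFun_ext (A := A) fun j => j.elim0)
    refine ⟨x, ?_⟩
    exact (congrArg (barEval A 1 1).hom hx).trans (if_pos (rfl : (1 : Fin 2) = 1) :
      (if (1 : Fin 2) = 1 then a else 0) = a)
  exact isIso_of_mono_of_epi _

lemma d_mooreBarEval (A : Ab.{0}) (i : ℕ) (hi : (ComplexShape.down ℕ).Rel i 1) :
    (N.obj (bar.obj A)).d i 1 ≫ mooreBarEval A = 0 := by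
  obtain rfl : i = 2 := hi.symm
  exact (isZero_moore_bar A 2 (by simp)).eq_of_src _ _

/-- The normalized complex of `K(A, 1)` is `A` in degree one. -/
def mooreBarToSingle : bar ⋙ N ⟶ HomologicalComplex.single Ab.{0} (ComplexShape.down ℕ) 1 where
  app A := HomologicalComplex.mkHomToSingle (mooreBarEval A) (d_mooreBarEval A)
  naturality A B f := by
    refine HomologicalComplex.hom_ext _ _ fun i => ?_
    by_cases hi : i = 1
    · subst hi
      have h : (N.map (bar.map f)).f 1 ≫ mooreBarEval B = mooreBarEval A ≫ f :=
        AddCommGrpCat.hom_ext (AddMonoidHom.ext fun x =>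
          congrArg (barEval B 1 1).hom (mooreIncl_map (bar.map f) 1 x))
      change (N.map (bar.map f)).f 1 ≫
          (HomologicalComplex.mkHomToSingle (mooreBarEval B) (d_mooreBarEval B)).f 1 =
        (HomologicalComplex.mkHomToSingle (mooreBarEval A) (d_mooreBarEval A)).f 1 ≫
          ((HomologicalComplex.single Ab.{0} (ComplexShape.down ℕ) 1).map f).f 1
      rw [HomologicalComplex.mkHomToSingle_f, HomologicalComplex.mkHomToSingle_f,
        HomologicalComplex.single_map_f_self, reassoc_of% h]
      simp
    · exact (HomologicalComplex.isZero_single_obj_X _ _ _ _ hi).eq_of_tgt _ _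

instance (A : Ab.{0}) : IsIso (mooreBarToSingle.app A) := by
  have : ∀ i, IsIso ((mooreBarToSingle.app A).f i) := fun i => by
    by_cases hi : i = 1
    · subst hi
      rw [show (mooreBarToSingle.app A).f 1 = _ from
        HomologicalComplex.mkHomToSingle_f _ (d_mooreBarEval A)]
      infer_instance
    · exact (isZero_moore_bar A i hi).isIso (HomologicalComplex.isZero_single_obj_X _ _ _ _ hi) _
  exact HomologicalComplex.Hom.isIso_of_components _

instance : IsIso mooreBarToSingle := NatIso.isIso_of_isIso_app _

lemma extendSingleIso_naturality {ι ι' : Type*} [DecidableEq ι] [DecidableEq ι'] {c : ComplexShape ι}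
    {c' : ComplexShape ι'} (e : c.Embedding c') {A B : Ab.{0}} (f : A ⟶ B) (i : ι) (i' : ι')
    (h : e.f i = i') :
    HomologicalComplex.extendMap ((HomologicalComplex.single Ab.{0} c i).map f) e ≫
        (HomologicalComplex.extendSingleIso e B i i' h).hom =
      (HomologicalComplex.extendSingleIso e A i i' h).hom ≫
        (HomologicalComplex.single Ab.{0} c' i').map f := by
  refine HomologicalComplex.hom_ext _ _ fun j => ?_
  by_cases hj : j = i'
  · subst hj
    rw [HomologicalComplex.comp_f, HomologicalComplex.comp_f,
      HomologicalComplex.extendSingleIso_hom_f, HomologicalComplex.extendSingleIso_hom_f,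
      HomologicalComplex.extendMap_f _ e h, HomologicalComplex.single_map_f_self,
      HomologicalComplex.single_map_f_self]
    simp
  · exact (HomologicalComplex.isZero_single_obj_X _ _ _ _ hj).eq_of_tgt _ _

/-- The shift of a complex concentrated in degree zero is concentrated in degree one. -/
def shiftSingleObjIso (A : Ab.{0}) :
    shiftComplex.obj ((HomologicalComplex.single Ab.{0} (ComplexShape.down ℕ) 0).obj A) ≅
      (HomologicalComplex.single Ab.{0} (ComplexShape.down ℕ) 1).obj A :=
  HomologicalComplex.extendSingleIso (ComplexShape.embeddingDown'Add 1 1) A 0 1 rfl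

/-- `shiftSingleObjIso` is natural. -/
def shiftSingleToSingle :
    HomologicalComplex.single Ab.{0} (ComplexShape.down ℕ) 0 ⋙ shiftComplex ≅
      HomologicalComplex.single Ab.{0} (ComplexShape.down ℕ) 1 :=
  NatIso.ofComponents shiftSingleObjIso (fun f =>
    extendSingleIso_naturality (ComplexShape.embeddingDown'Add 1 1) f 0 1 rfl)

/-- The shift of `A`, as a complex in degree zero, is the normalized complex of `K(A, 1)`. -/
def shiftSingleIso : HomologicalComplex.single Ab.{0} (ComplexShape.down ℕ) 0 ⋙ shiftComplex ≅
    bar ⋙ N :=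
  shiftSingleToSingle ≪≫ (asIso mooreBarToSingle).symm

/-- All functions on the vertices form a free group. The pointed functions and the normalized part
are subgroups of it, and subgroups of projective abelian groups are projective. -/
lemma projective_moore_bar (A : Ab.{0}) [Module.Free ℤ A] [Module.Finite ℤ A] (n : ℕ) :
    Projective ((N.obj (bar.obj A)).X n) := by
  have : Module.Projective ℤ (pointedFun A n) :=
    projective_of_injective (pointedFun A n).subtype.toIntLinearMap Subtype.val_injective
  have : Module.Projective ℤ ((bar.obj A).obj (op ⦋n⦌)) := this
  exact projective_of_mono (mooreIncl (bar.obj A) n)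

end Bar

section Comparison

open Abelian.DoldKan

/-! ### Derived functors on the shift of a free abelian group -/

/-- An abelian group as an object of the derived category, in degree zero. -/
def inDegreeZero : Ab.{0} ⥤ DAb := HomologicalComplex.single Ab.{0} (ComplexShape.down ℕ) 0 ⋙ Q

/-- The natural map from the left derived functor of `T` to `T`. -/
def LeftDerivable.counit {T : Ch ⥤ Ch} (hT : LeftDerivable T) : Q ⋙ hT.derived ⟶ T ⋙ Q :=
  (Localization.Lifting.iso Q W (resolution ⋙ T ⋙ Q) hT.derived).hom ≫
    (Functor.whiskerRight (Functor.whiskerRight resolutionEval T) Q :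
      (resolution ⋙ T) ⋙ Q ⟶ (𝟭 Ch ⋙ T) ⋙ Q)

lemma LeftDerivable.isIso_counit_app {T : Ch ⥤ Ch} (hT : LeftDerivable T) (K : Ch)
    [∀ n, Projective (K.X n)] : IsIso (hT.counit.app K) := by
  have : QuasiIso (resolutionEval.app K) := inferInstance
  have : ∀ n, Projective (((𝟭 Ch).obj K).X n) := fun n => inferInstanceAs (Projective (K.X n))
  have h : QuasiIso (T.map (resolutionEval.app K)) := hT.quasiIso_map _
  have : IsIso (Q.map (T.map (resolutionEval.app K))) := Localization.inverts Q W _ h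
  exact inferInstanceAs (IsIso ((Localization.Lifting.iso Q W (resolution ⋙ T ⋙ Q)
    hT.derived).hom.app K ≫ Q.map (T.map (resolutionEval.app K))))

/-- This reduces the abstract map of derived functors to `α` itself on unresolved complexes; it is
naturality of `α` along the resolution map. -/
lemma derivedMap_app_counit {S T : Ch ⥤ Ch} (hS : LeftDerivable S) (hT : LeftDerivable T)
    (α : S ⟶ T) (K : Ch) :
    (derivedMap hS hT α).app (Q.obj K) ≫ hT.counit.app K =
      hS.counit.app K ≫ Q.map (α.app K) := by
  have h := Localization.liftNatTrans_app Q W (resolution ⋙ S ⋙ Q) (resolution ⋙ T ⋙ Q)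
    hS.derived hT.derived (Functor.whiskerLeft resolution (Functor.whiskerRight α Q)) K
  refine (congrArg (· ≫ hT.counit.app K) h).trans ?_
  have hn : Q.map (α.app (resolution.obj K)) ≫ Q.map (T.map (resolutionEval.app K)) =
      Q.map (S.map (resolutionEval.app K)) ≫ Q.map (α.app K) := by
    rw [← Q.map_comp, ← Q.map_comp]
    exact congrArg Q.map (α.naturality (resolutionEval.app K)).symm
  change (_ ≫ Q.map (α.app (resolution.obj K)) ≫ _) ≫ _ ≫ Q.map (T.map (resolutionEval.app K)) =
    (_ ≫ Q.map (S.map (resolutionEval.app K))) ≫ _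
  simp only [Category.assoc, Iso.inv_hom_id_app_assoc]
  exact congrArg (_ ≫ ·) hn

/-- The shift on complexes and on the derived category. -/
def shiftFac : Q ⋙ shift ≅ shiftComplex ⋙ Q := Localization.fac _ _ _

/-- The shift of an abelian group in degree zero. -/
def shiftInDegreeZero : inDegreeZero ⋙ shift ≅ bar ⋙ N ⋙ Q :=
  (Functor.isoWhiskerLeft (HomologicalComplex.single Ab.{0} (ComplexShape.down ℕ) 0) shiftFac :
    _ ≅ (HomologicalComplex.single Ab.{0} (ComplexShape.down ℕ) 0 ⋙ shiftComplex) ⋙ Q) ≪≫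
  (Functor.isoWhiskerRight shiftSingleIso Q : _ ≅ (bar ⋙ N) ⋙ Q)

/-- The left derived functor of `T` on shifts of abelian groups, compared with `T`. -/
def LeftDerivable.barComparison {T : Ch ⥤ Ch} (hT : LeftDerivable T) :
    inDegreeZero ⋙ shift ⋙ hT.derived ⟶ bar ⋙ N ⋙ T ⋙ Q :=
  (Functor.whiskerRight shiftInDegreeZero.hom hT.derived :
    (inDegreeZero ⋙ shift) ⋙ hT.derived ⟶ (bar ⋙ N) ⋙ Q ⋙ hT.derived) ≫
  Functor.whiskerLeft (bar ⋙ N) hT.counit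

lemma LeftDerivable.isIso_barComparison_app {T : Ch ⥤ Ch} (hT : LeftDerivable T) (A : Ab.{0})
    [Module.Free ℤ A] [Module.Finite ℤ A] : IsIso (hT.barComparison.app A) := by
  have := projective_moore_bar A
  have := hT.isIso_counit_app (N.obj (bar.obj A))
  exact inferInstanceAs (IsIso (hT.derived.map (shiftInDegreeZero.hom.app A) ≫
    hT.counit.app (N.obj (bar.obj A))))

lemma derivedMap_app_barComparison {S T : Ch ⥤ Ch} (hS : LeftDerivable S) (hT : LeftDerivable T)
    (α : S ⟶ T) (A : Ab.{0}) :
    (derivedMap hS hT α).app (shift.obj (inDegreeZero.obj A)) ≫ hT.barComparison.app A =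
      hS.barComparison.app A ≫ Q.map (α.app (N.obj (bar.obj A))) := by
  change _ ≫ hT.derived.map (shiftInDegreeZero.hom.app A) ≫ hT.counit.app _ =
    (hS.derived.map (shiftInDegreeZero.hom.app A) ≫ hS.counit.app _) ≫ _
  rw [Category.assoc, ← derivedMap_app_counit hS hT]
  exact (Category.assoc _ _ _).symm.trans ((congrArg (· ≫ hT.counit.app (N.obj (bar.obj A)))
    ((derivedMap hS hT α).naturality (shiftInDegreeZero.hom.app A)).symm).trans
      (Category.assoc _ _ _))

/-- Apply a functor of abelian groups to `K(A, 1)` and normalize. -/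
def barPlus (F : Ab.{0} ⥤ Ab.{0}) : Ab.{0} ⥤ Ch :=
  bar ⋙ (SimplicialObject.whiskering _ _).obj F ⋙ N

/-- The functor `prolong F` on normalized complexes. -/
def prolongMoore (F : Ab.{0} ⥤ Ab.{0}) :
    N ⋙ prolong F ≅ (SimplicialObject.whiskering _ _).obj F ⋙ N :=
  (Functor.isoWhiskerRight (equivalence (A := Ab.{0})).unitIso.symm
    ((SimplicialObject.whiskering _ _).obj F ⋙ N) :
      (N ⋙ Γ) ⋙ (SimplicialObject.whiskering _ _).obj F ⋙ N ≅
        𝟭 _ ⋙ (SimplicialObject.whiskering _ _).obj F ⋙ N)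

/-- The derived functor of `F` on shifts of abelian groups. -/
def leftDerivedComparison (F : Ab.{0} ⥤ Ab.{0}) :
    inDegreeZero ⋙ shift ⋙ leftDerived F ⟶ barPlus F ⋙ Q :=
  (leftDerivable_prolong F).barComparison ≫
    (Functor.whiskerLeft bar (Functor.whiskerRight (prolongMoore F).hom Q) :
      bar ⋙ (N ⋙ prolong F) ⋙ Q ⟶ bar ⋙ ((SimplicialObject.whiskering _ _).obj F ⋙ N) ⋙ Q)

/-- For such `A` the normalized complex of `K(A, 1)` is its own projective resolution, and `Γ` turns
it back into `K(A, 1)`. All computations below rest on this. -/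
lemma isIso_leftDerivedComparison_app (F : Ab.{0} ⥤ Ab.{0}) (A : Ab.{0})
    [Module.Free ℤ A] [Module.Finite ℤ A] : IsIso ((leftDerivedComparison F).app A) := by
  have := (leftDerivable_prolong F).isIso_barComparison_app A
  exact inferInstanceAs (IsIso ((leftDerivable_prolong F).barComparison.app A ≫
    Q.map ((prolongMoore F).hom.app (bar.obj A))))

/-- Functoriality of `barPlus` in the functor of abelian groups. -/
def barPlusMap {F G : Ab.{0} ⥤ Ab.{0}} (α : F ⟶ G) : barPlus F ⟶ barPlus G :=
  Functor.whiskerLeft bar (Functor.whiskerRight ((SimplicialObject.whiskering _ _).map α) N)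

lemma derivedMap_app_leftDerivedComparison {F G : Ab.{0} ⥤ Ab.{0}} (α : F ⟶ G) (A : Ab.{0}) :
    (derivedMap (leftDerivable_prolong F) (leftDerivable_prolong G) (prolongMap α)).app
        (shift.obj (inDegreeZero.obj A)) ≫ (leftDerivedComparison G).app A =
      (leftDerivedComparison F).app A ≫ Q.map ((barPlusMap α).app A) := by
  change _ ≫ (leftDerivable_prolong G).barComparison.app A ≫
      Q.map ((prolongMoore G).hom.app (bar.obj A)) =
    ((leftDerivable_prolong F).barComparison.app A ≫
      Q.map ((prolongMoore F).hom.app (bar.obj A))) ≫ _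
  have h := derivedMap_app_barComparison (leftDerivable_prolong F) (leftDerivable_prolong G)
    (prolongMap α) A
  have hn : (prolongMap α).app (N.obj (bar.obj A)) ≫ (prolongMoore G).hom.app (bar.obj A) =
      (prolongMoore F).hom.app (bar.obj A) ≫ (barPlusMap α).app A :=
    (N.map_comp _ _).symm.trans ((congrArg N.map (((SimplicialObject.whiskering Ab.{0} Ab.{0}).map
      α).naturality ((equivalence (A := Ab.{0})).unitIso.inv.app (bar.obj A))).symm).trans
        (N.map_comp _ _))
  refine (Category.assoc _ _ _).symm.trans ((congrArg (· ≫ _) h).trans ?_)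
  refine (Category.assoc _ _ _).trans (Eq.trans ?_ (Category.assoc _ _ _).symm)
  refine congrArg (_ ≫ ·) ?_
  exact (Q.map_comp _ _).symm.trans ((congrArg Q.map hn).trans (Q.map_comp _ _))

end Comparison

section Acyclic

/-! ### Acyclic complexes -/

variable {X : Ch}

/-- A construction that inverts quasi-isomorphisms must therefore make the zero endomorphism of an
acyclic complex invertible, which trivializes its value there. -/
lemma quasiIso_zero_of_exactAt (hX : ∀ n, X.ExactAt n) : QuasiIso (0 : X ⟶ X) :=
  ⟨fun n => (quasiIsoAt_iff_exactAt _ _ (hX n)).2 (hX n)⟩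

lemma modTwoH_eq_zero_of_exactAt (hX : ∀ n, X.ExactAt n) (z : ModTwoH X) : z = 0 := by
  have := quasiIso_zero_of_exactAt hX
  obtain ⟨y, rfl⟩ := (bijective_modTwoHMap (0 : X ⟶ X)).2 z
  obtain ⟨a, b, h, h', rfl⟩ := modTwoH_cases y
  rfl

end Acyclic

/-! ### Acyclic complexes as initial objects of the derived category. -/

section Initial

/-- The zero map, as a natural transformation on the derived category. -/
def fromZero (X : Ch) : (Functor.const DAb).obj (Q.obj X) ⟶ 𝟭 DAb :=
  letI : Localization.Lifting Q W ((Functor.const Ch).obj (Q.obj X))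
    ((Functor.const DAb).obj (Q.obj X)) := ⟨Iso.refl _⟩
  letI : Localization.Lifting Q W Q (𝟭 DAb) := ⟨Iso.refl _⟩
  Localization.liftNatTrans Q W ((Functor.const Ch).obj (Q.obj X)) Q _ _
    { app Y := Q.map 0
      naturality Y Z f := by
        rw [← Q.map_comp, Limits.zero_comp]; exact Category.id_comp _ }

lemma fromZero_app (X Y : Ch) : (fromZero X).app (Q.obj Y) = Q.map 0 := by
  let _ : Localization.Lifting Q W ((Functor.const Ch).obj (Q.obj X))
    ((Functor.const DAb).obj (Q.obj X)) := ⟨Iso.refl _⟩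
  let _ : Localization.Lifting Q W Q (𝟭 DAb) := ⟨Iso.refl _⟩
  refine (Localization.liftNatTrans_app Q W ((Functor.const Ch).obj (Q.obj X)) Q _ _ _ Y).trans ?_
  exact (Category.id_comp _).trans (Category.comp_id _)

/-- An acyclic complex is initial in the derived category. -/
def isInitialOfExactAt {X : Ch} (hX : ∀ n, X.ExactAt n) : Limits.IsInitial (Q.obj X) :=
  Limits.IsInitial.ofUniqueHom (fun Y => (fromZero X).app Y) fun Y g => by
    -- The zero endomorphism is idempotent, and `Q` inverts it, so its image is the identity.
    have h1 : Q.map (0 : X ⟶ X) = 𝟙 _ := by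
      have : IsIso (Q.map (0 : X ⟶ X)) :=
        Localization.inverts Q W _ (quasiIso_zero_of_exactAt hX)
      rw [← cancel_mono (Q.map (0 : X ⟶ X)), ← Q.map_comp, Limits.zero_comp, Category.id_comp]
    -- The component of `fromZero X` at `Q.obj X` is the identity by `h1`, so naturality along `g`
    -- determines `g`.
    have h2 := (fromZero X).naturality g
    rw [fromZero_app, h1] at h2
    exact (Category.id_comp _).symm.trans (h2.symm.trans (Category.id_comp _))

end Initial

section DegreeTwo

/-! ### Elements of the symmetric square and of the second divided power -/

section
variable {A B : Type} [AddCommGroup A] [AddCommGroup B]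

/-- The element `γ₂(x)`. -/
def gammaTwoSq (x : A) : gammaTwo A :=
  ⟨DividedPowerAlgebra.dp ℤ 2 x, Submodule.subset_span (Or.inl ⟨x, rfl⟩)⟩

/-- The element `γ₁(x) γ₁(y)`. -/
def gammaTwoMul : A →+ A →+ gammaTwo A :=
  AddMonoidHom.mk' (fun x => AddMonoidHom.mk' (fun y =>
    ⟨DividedPowerAlgebra.dp ℤ 1 x * DividedPowerAlgebra.dp ℤ 1 y,
      Submodule.subset_span (Or.inr ⟨x, y, rfl⟩)⟩) fun y z => Subtype.ext (by
        simp only [← DividedPowerAlgebra.embed_def, map_add, mul_add]; rfl))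
    fun x y => AddMonoidHom.ext fun z => Subtype.ext (by
      simp only [← DividedPowerAlgebra.embed_def, map_add, add_mul, AddMonoidHom.mk'_apply]; rfl)

/-- The element `x y`. -/
def symSquareMul : A →+ A →+ symSquare A :=
  AddMonoidHom.mk' (fun x => AddMonoidHom.mk' (fun y =>
    ⟨SymmetricAlgebra.ι ℤ A x * SymmetricAlgebra.ι ℤ A y,
      Submodule.subset_span ⟨x, y, rfl⟩⟩) fun y z => Subtype.ext (by
        simp only [map_add, mul_add]; rfl))
    fun x y => AddMonoidHom.ext fun z => Subtype.ext (by
      simp only [map_add, add_mul, AddMonoidHom.mk'_apply]; rfl)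

end

section
variable {A B : Ab.{0}}

/-- The element `γ₂(x)` of `Gamma2.obj A`. -/
def gammaSq (x : A) : Gamma2.obj A := gammaTwoSq x

/-- The element `γ₁(x) γ₁(y)` of `Gamma2.obj A`. -/
def gammaMul : A →+ A →+ Gamma2.obj A := gammaTwoMul

/-- The element `x y` of `SP2.obj A`. -/
def symMul : A →+ A →+ SP2.obj A := symSquareMul

lemma gammaMul_comm (x y : A) : gammaMul x y = gammaMul y x := Subtype.ext (mul_comm _ _)

lemma symMul_comm (x y : A) : symMul x y = symMul y x := Subtype.ext (mul_comm _ _)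

lemma gammaMul_self (x : A) : gammaMul x x = (2 : ℤ) • gammaSq x :=
  Subtype.ext (DividedPowerAlgebra.dp_mul.trans (natCast_zsmul _ 2).symm)

lemma gammaSq_add (x y : A) : gammaSq (x + y) = gammaSq x + gammaMul x y + gammaSq y :=
  Subtype.ext (by
    refine DividedPowerAlgebra.dp_add.trans ?_
    simp only [Finset.Nat.antidiagonal_succ, Finset.Nat.antidiagonal_zero]
    change _ = DividedPowerAlgebra.dp ℤ 2 x +
      DividedPowerAlgebra.dp ℤ 1 x * DividedPowerAlgebra.dp ℤ 1 y + DividedPowerAlgebra.dp ℤ 2 y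
    simp [DividedPowerAlgebra.dp_zero]
    abel)

lemma gammaSq_zsmul (n : ℤ) (x : A) : gammaSq (n • x) = n ^ 2 • gammaSq x :=
  Subtype.ext DividedPowerAlgebra.dp_smul

lemma gammaSq_zero : gammaSq (0 : A) = 0 :=
  Subtype.ext (DividedPowerAlgebra.dp_null_of_ne_zero two_ne_zero)

lemma gammaTwo_induction {p : Gamma2.obj A → Prop} (sq : ∀ x, p (gammaSq x))
    (mul : ∀ x y, p (gammaMul x y)) (zero : p 0) (add : ∀ x y, p x → p y → p (x + y))
    (smul : ∀ (n : ℤ) x, p x → p (n • x)) (z : Gamma2.obj A) : p z := by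
  obtain ⟨z, hz⟩ := z
  induction hz using Submodule.span_induction with
  | mem z hz =>
    rcases hz with ⟨x, rfl⟩ | ⟨x, y, rfl⟩
    · exact sq x
    · exact mul x y
  | zero => exact zero
  | add x y hx hy ihx ihy => exact add _ _ ihx ihy
  | smul n x hx ih => exact smul _ _ ih

lemma symSquare_induction {p : SP2.obj A → Prop}
    (mul : ∀ x y, p (symMul x y)) (zero : p 0) (add : ∀ x y, p x → p y → p (x + y))
    (smul : ∀ (n : ℤ) x, p x → p (n • x)) (z : SP2.obj A) : p z := by
  obtain ⟨z, hz⟩ := z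
  induction hz using Submodule.span_induction with
  | mem z hz =>
    obtain ⟨x, y, rfl⟩ := hz
    exact mul x y
  | zero => exact zero
  | add x y hx hy ihx ihy => exact add _ _ ihx ihy
  | smul n x hx ih => exact smul _ _ ih

/-- Only spanning is needed here; rank one is covered by `e' = 0`, and coefficients are later
detected by faces and `gammaEval`. -/
lemma gammaTwo_exists_coeff {e e' : A} (h : ∀ x : A, ∃ a b : ℤ, x = a • e + b • e')
    (z : Gamma2.obj A) :
    ∃ a b c : ℤ, z = a • gammaSq e + b • gammaMul e e' + c • gammaSq e' := by
  induction z using gammaTwo_induction with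
  | sq x =>
    obtain ⟨a, b, rfl⟩ := h x
    refine ⟨a ^ 2, a * b, b ^ 2, ?_⟩
    rw [gammaSq_add, gammaSq_zsmul, gammaSq_zsmul]
    simp only [map_zsmul, AddMonoidHom.smul_apply, smul_smul, mul_comm]
  | mul x y =>
    obtain ⟨a, b, rfl⟩ := h x
    obtain ⟨c, d, rfl⟩ := h y
    refine ⟨2 * (a * c), a * d + b * c, 2 * (b * d), ?_⟩
    simp only [map_add, map_zsmul, AddMonoidHom.add_apply, AddMonoidHom.smul_apply, gammaMul_self,
      gammaMul_comm e' e]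
    module
  | zero => exact ⟨0, 0, 0, by simp⟩
  | add x y hx hy =>
    obtain ⟨a, b, c, rfl⟩ := hx
    obtain ⟨a', b', c', rfl⟩ := hy
    exact ⟨a + a', b + b', c + c', by module⟩
  | smul n x hx =>
    obtain ⟨a, b, c, rfl⟩ := hx
    exact ⟨n * a, n * b, n * c, by module⟩

lemma symSquare_exists_coeff {e e' : A} (h : ∀ x : A, ∃ a b : ℤ, x = a • e + b • e')
    (z : SP2.obj A) :
    ∃ a b c : ℤ, z = a • symMul e e + b • symMul e e' + c • symMul e' e' := by
  induction z using symSquare_induction with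
  | mul x y =>
    obtain ⟨a, b, rfl⟩ := h x
    obtain ⟨c, d, rfl⟩ := h y
    refine ⟨a * c, a * d + b * c, b * d, ?_⟩
    simp only [map_add, map_zsmul, AddMonoidHom.add_apply, AddMonoidHom.smul_apply,
      symMul_comm e' e]
    module
  | zero => exact ⟨0, 0, 0, by simp⟩
  | add x y hx hy =>
    obtain ⟨a, b, c, rfl⟩ := hx
    obtain ⟨a', b', c', rfl⟩ := hy
    exact ⟨a + a', b + b', c + c', by module⟩
  | smul n x hx =>
    obtain ⟨a, b, c, rfl⟩ := hx
    exact ⟨n * a, n * b, n * c, by module⟩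

open scoped Classical in
/-- The divided power algebra acts as polynomial functions on the dual. -/
lemma exists_gammaEval (l : A →+ ℤ) : ∃ q : Gamma2.obj A →+ ℚ,
    (∀ x, q (gammaSq x) = (l x : ℚ) ^ 2 / 2) ∧ ∀ x y, q (gammaMul x y) = l x * l y := by
  -- All of `ℚ` carries the divided powers `xⁿ / n!`, so `l` extends to an algebra map. Its value on
  -- `γ₂(x)` is only half-integral.
  let g : DividedPowerAlgebra ℤ A →ₐ[ℤ] ℚ :=
    DividedPowerAlgebra.lift (DividedPowers.RatAlgebra.dividedPowers (⊤ : Ideal ℚ))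
      (Algebra.linearMap ℤ ℚ ∘ₗ l.toIntLinearMap) fun _ => trivial
  have hg : ∀ n x, g (DividedPowerAlgebra.dp ℤ n x) = (l x : ℚ) ^ n / n.factorial := fun n x => by
    refine (DividedPowerAlgebra.lift_apply_dp _ _ n x).trans ?_
    refine (DividedPowers.RatAlgebra.dpow_apply (I := (⊤ : Ideal ℚ))).trans ((if_pos trivial).trans ?_)
    rw [Ring.inverse_eq_inv', div_eq_inv_mul]
    rfl
  refine ⟨(g.toLinearMap ∘ₗ (gammaTwo A).subtype).toAddMonoidHom, fun x => ?_, fun x y => ?_⟩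
  · refine (hg 2 x).trans ?_
    norm_num
  · refine (map_mul g (DividedPowerAlgebra.dp ℤ 1 x) (DividedPowerAlgebra.dp ℤ 1 y)).trans ?_
    rw [hg, hg]
    norm_num

/-- Evaluation of elements of `Γ₂(A)` as quadratic functions on the dual of `A`. -/
def gammaEval (l : A →+ ℤ) : Gamma2.obj A →+ ℚ := (exists_gammaEval l).choose

lemma gammaEval_sq (l : A →+ ℤ) (x : A) : gammaEval l (gammaSq x) = (l x : ℚ) ^ 2 / 2 :=
  (exists_gammaEval l).choose_spec.1 x

lemma gammaEval_mul (l : A →+ ℤ) (x y : A) : gammaEval l (gammaMul x y) = l x * l y :=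
  (exists_gammaEval l).choose_spec.2 x y

/-- The polarization of `gammaEval` is integral. -/
lemma exists_polar_gammaEval (l m : A →+ ℤ) (z : Gamma2.obj A) :
    ∃ k : ℤ, gammaEval (l + m) z - gammaEval l z - gammaEval m z = k := by
  induction z using gammaTwo_induction with
  | sq x =>
    refine ⟨l x * m x, ?_⟩
    simp only [gammaEval_sq, AddMonoidHom.add_apply]
    push_cast
    ring
  | mul x y =>
    refine ⟨l x * m y + m x * l y, ?_⟩
    simp only [gammaEval_mul, AddMonoidHom.add_apply]
    push_cast
    ring
  | zero => exact ⟨0, by simp⟩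
  | add x y hx hy =>
    obtain ⟨a, ha⟩ := hx
    obtain ⟨b, hb⟩ := hy
    refine ⟨a + b, ?_⟩
    simp only [map_add]
    push_cast
    linarith
  | smul n x hx =>
    obtain ⟨a, ha⟩ := hx
    refine ⟨n * a, ?_⟩
    simp only [map_zsmul, zsmul_eq_mul]
    push_cast
    rw [← ha]
    ring

lemma gammaSq_zsmul_eq_zero {l : A →+ ℤ} {e : A} (he : l e = 1) {n : ℤ}
    (h : n • gammaSq e = 0) : n = 0 := by
  have := congrArg (gammaEval l) h
  rw [map_zsmul, gammaEval_sq, he, map_zero] at this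
  simpa using this

/-- Elements of the symmetric square give quadratic functions on the dual. -/
lemma symMul_self_zsmul_eq_zero {l : A →+ ℤ} {e : A} (he : l e = 1) {n : ℤ}
    (h : n • symMul e e = 0) : n = 0 := by
  have h1 := congrArg (fun z : SP2.obj A => SymmetricAlgebra.lift l.toIntLinearMap z.1) h
  have h2 : SymmetricAlgebra.lift l.toIntLinearMap
      (n • (SymmetricAlgebra.ι ℤ A e * SymmetricAlgebra.ι ℤ A e)) = 0 :=
    h1.trans (map_zero (SymmetricAlgebra.lift l.toIntLinearMap))
  rw [map_zsmul, map_mul, SymmetricAlgebra.lift_ι_apply] at h2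
  simpa [he] using h2

end

section
variable {A B : Ab.{0}}

lemma Gamma2_map_sq (f : A ⟶ B) (x : A) : (Gamma2.map f).hom (gammaSq x) = gammaSq (f.hom x) :=
  Subtype.ext (DividedPowerAlgebra.map_apply_dp ℤ _)

lemma Gamma2_map_mul (f : A ⟶ B) (x y : A) :
    (Gamma2.map f).hom (gammaMul x y) = gammaMul (f.hom x) (f.hom y) :=
  Subtype.ext ((map_mul (DividedPowerAlgebra.map ℤ f.hom.toIntLinearMap) _ _).trans
    (congrArg₂ (· * ·) (DividedPowerAlgebra.map_apply_dp ℤ _) (DividedPowerAlgebra.map_apply_dp ℤ _)))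

lemma SP2_map_mul (f : A ⟶ B) (x y : A) :
    (SP2.map f).hom (symMul x y) = symMul (f.hom x) (f.hom y) :=
  Subtype.ext ((map_mul (SymmetricAlgebra.lift _) _ _).trans
    (congrArg₂ (· * ·) (SymmetricAlgebra.lift_ι_apply _ _) (SymmetricAlgebra.lift_ι_apply _ _)))

lemma SP2ToGamma2_mul (x y : A) :
    (SP2ToGamma2.app A).hom (symMul x y) = gammaMul x y :=
  Subtype.ext ((map_mul (SymmetricAlgebra.lift _) _ _).trans
    (congrArg₂ (· * ·) (SymmetricAlgebra.lift_ι_apply _ _) (SymmetricAlgebra.lift_ι_apply _ _)))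

end

/-- A functor of degree at most two. -/
structure IsQuadratic (F : Ab.{0} ⥤ Ab.{0}) : Prop where
  map_add_add : ∀ {A B : Ab.{0}} (f g h : A ⟶ B),
    F.map (f + g + h) + F.map f + F.map g + F.map h =
      F.map (f + g) + F.map (f + h) + F.map (g + h)

lemma isQuadratic_Gamma2 : IsQuadratic Gamma2 where
  map_add_add {A B} f g h := by
    refine AddCommGrpCat.hom_ext (AddMonoidHom.ext fun z => ?_)
    induction z using gammaTwo_induction with
    | sq x =>
      simp only [AddCommGrpCat.hom_add_apply]
      rw [Gamma2_map_sq, Gamma2_map_sq, Gamma2_map_sq, Gamma2_map_sq, Gamma2_map_sq,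
        Gamma2_map_sq, Gamma2_map_sq]
      simp only [AddCommGrpCat.hom_add, AddMonoidHom.add_apply, gammaSq_add, map_add]
      abel
    | mul x y =>
      simp only [AddCommGrpCat.hom_add_apply]
      rw [Gamma2_map_mul, Gamma2_map_mul, Gamma2_map_mul, Gamma2_map_mul, Gamma2_map_mul,
        Gamma2_map_mul, Gamma2_map_mul]
      simp only [AddCommGrpCat.hom_add, AddMonoidHom.add_apply, map_add]
      abel
    | zero => exact (map_zero _).trans (map_zero _).symm
    | add x y hx hy => exact (map_add _ _ _).trans ((congrArg₂ (· + ·) hx hy).trans (map_add _ _ _).symm)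
    | smul n x hx => exact (map_zsmul _ _ _).trans ((congrArg (n • ·) hx).trans (map_zsmul _ _ _).symm)

lemma isQuadratic_SP2 : IsQuadratic SP2 where
  map_add_add {A B} f g h := by
    refine AddCommGrpCat.hom_ext (AddMonoidHom.ext fun z => ?_)
    induction z using symSquare_induction with
    | mul x y =>
      simp only [AddCommGrpCat.hom_add_apply]
      rw [SP2_map_mul, SP2_map_mul, SP2_map_mul, SP2_map_mul, SP2_map_mul,
        SP2_map_mul, SP2_map_mul]
      simp only [AddCommGrpCat.hom_add, AddMonoidHom.add_apply, map_add]
      abel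
    | zero => exact (map_zero _).trans (map_zero _).symm
    | add x y hx hy => exact (map_add _ _ _).trans ((congrArg₂ (· + ·) hx hy).trans (map_add _ _ _).symm)
    | smul n x hx => exact (map_zsmul _ _ _).trans ((congrArg (n • ·) hx).trans (map_zsmul _ _ _).symm)

end DegreeTwo

section QuadraticMoore

open Abelian.DoldKan Opposite Simplicial

/-! ### Quadratic functors on `K(A, 1)` -/

variable {A B : Ab.{0}}

lemma bar_apply_eq_zero {n : ℕ} {i : Fin (n + 1)} {u : pointedFun A (n + 1)}
    (hu : ((bar.obj A).δ i.succ).hom u = 0) {j : Fin (n + 1)} (hj : j ≠ i) : u.1 j.succ = 0 := by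
  obtain ⟨k, hk⟩ := Fin.exists_succAbove_eq (x := j.succ) (y := i.succ)
    (fun h => hj (Fin.succ_injective _ h))
  have := bar_δ_succ_apply i u k
  rw [hu, hk] at this
  exact this.symm

/-- Restrict a simplex of `K(A, 1)` to a set of vertices. -/
def barRestrict {n : ℕ} (S : Finset (Fin n)) :
    (bar.obj A).obj (op ⦋n⦌) ⟶ (bar.obj A).obj (op ⦋n⦌) :=
  AddCommGrpCat.ofHom
    { toFun := fun u : pointedFun A n =>
        (⟨Fin.cons 0 fun j => if j ∈ S then u.1 j.succ else 0, rfl⟩ : pointedFun A n)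
      map_zero' := pointedFun_ext fun j => ite_self _
      map_add' := fun u v => pointedFun_ext fun j => by
        change (if j ∈ S then u.1 j.succ + v.1 j.succ else 0) =
          (if j ∈ S then u.1 j.succ else 0) + (if j ∈ S then v.1 j.succ else 0)
        split_ifs <;> simp }

lemma barRestrict_apply {n : ℕ} (S : Finset (Fin n)) (u : pointedFun A n) (j : Fin n) :
    ((barRestrict (A := A) S).hom u).1 j.succ = if j ∈ S then u.1 j.succ else 0 := rfl

/-- The difference between a simplex `u` and `σ i` of its face `δ i.succ` is supported at the vertex
`i.succ`, so `φ` kills it and factors through that face. Functoriality of `F` then suffices;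
additivity is not available. -/
lemma map_apply_eq_zero_of_face (F : Ab.{0} ⥤ Ab.{0}) {n : ℕ} (i : Fin (n + 1))
    {φ : (bar.obj A).obj (op ⦋n + 1⦌) ⟶ B} {y : F.obj ((bar.obj A).obj (op ⦋n + 1⦌))}
    (hφ : ∀ u : pointedFun A (n + 1), (∀ j ≠ i, u.1 j.succ = 0) → φ.hom u = 0)
    (hy : (F.map ((bar.obj A).δ i.succ)).hom y = 0) : (F.map φ).hom y = 0 := by
  have h : φ = (bar.obj A).δ i.succ ≫ (bar.obj A).σ i ≫ φ := by
    refine AddCommGrpCat.hom_ext (AddMonoidHom.ext fun u => ?_)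
    refine sub_eq_zero.1 ((map_sub φ.hom u _).symm.trans (hφ _ fun j hj => ?_))
    refine bar_apply_eq_zero (A := A) ?_ hj
    refine (map_sub ((bar.obj A).δ i.succ).hom u _).trans (sub_eq_zero.2 ?_)
    exact (congrArg (fun t : (bar.obj A).obj (op ⦋n⦌) ⟶ _ => t.hom (((bar.obj A).δ i.succ).hom u))
      ((bar.obj A).δ_comp_σ_succ (i := i))).symm
  rw [h, F.map_comp, hom_comp_apply, hy, map_zero]

/-- The simplicial abelian group obtained from `K(A, 1)` by applying `F`. -/
abbrev barApply (F : Ab.{0} ⥤ Ab.{0}) (A : Ab.{0}) : SimplicialObject Ab.{0} :=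
  ((SimplicialObject.whiskering _ _).obj F).obj (bar.obj A)

/-- The inclusion of the normalized complex of `barApply F A`. -/
def barIncl (F : Ab.{0} ⥤ Ab.{0}) (A : Ab.{0}) (n : ℕ) :
    ((barPlus F).obj A).X n ⟶ F.obj ((bar.obj A).obj (op ⦋n⦌)) :=
  mooreIncl (barApply F A) n

section
variable {F G : Ab.{0} ⥤ Ab.{0}}

lemma barIncl_injective {n : ℕ} : Function.Injective (barIncl F A n).hom := mooreIncl_injective

lemma map_δ_barIncl {n : ℕ} (i : Fin (n + 1)) (x : ((barPlus F).obj A).X (n + 1)) :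
    (F.map ((bar.obj A).δ i.succ)).hom ((barIncl F A (n + 1)).hom x) = 0 := δ_mooreIncl i x

lemma exists_barIncl_eq {n : ℕ} (y : F.obj ((bar.obj A).obj (op ⦋n + 1⦌)))
    (hy : ∀ i : Fin (n + 1), (F.map ((bar.obj A).δ i.succ)).hom y = 0) :
    ∃ x, (barIncl F A (n + 1)).hom x = y :=
  exists_mooreIncl_eq (Y := barApply F A) y hy

lemma barIncl_d {n : ℕ} (x : ((barPlus F).obj A).X (n + 1)) :
    (barIncl F A n).hom ((((barPlus F).obj A).d (n + 1) n).hom x) =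
      (F.map ((bar.obj A).δ 0)).hom ((barIncl F A (n + 1)).hom x) := mooreIncl_d x

lemma barIncl_map (f : A ⟶ B) (n : ℕ) (x : ((barPlus F).obj A).X n) :
    (barIncl F B n).hom ((((barPlus F).map f).f n).hom x) =
      (F.map ((bar.map f).app (op ⦋n⦌))).hom ((barIncl F A n).hom x) := mooreIncl_map _ n x

lemma barIncl_barPlusMap (α : F ⟶ G) (n : ℕ) (x : ((barPlus F).obj A).X n) :
    (barIncl G A n).hom ((((barPlusMap α).app A).f n).hom x) =
      (α.app ((bar.obj A).obj (op ⦋n⦌))).hom ((barIncl F A n).hom x) := mooreIncl_map _ n x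

end

/-- With at least three nonzero vertices, the identity is a sum of three restrictions such that each
of them, and each sum of two, ignores some vertex and hence kills normalized elements under `F`. The
quadratic identity then kills them under `F.map (𝟙 _)` as well. -/
lemma IsQuadratic.moore_eq_zero {F : Ab.{0} ⥤ Ab.{0}} (hF : IsQuadratic F) (n : ℕ)
    (x : ((barPlus F).obj A).X (n + 3)) : x = 0 := by
  apply barIncl_injective
  rw [map_zero]
  set y := (barIncl F A (n + 3)).hom x with hy
  have hd : ∀ i : Fin (n + 3), (F.map ((bar.obj A).δ i.succ)).hom y = 0 := fun i =>
    map_δ_barIncl i x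
  let f := barRestrict (A := A) {(0 : Fin (n + 3))}
  let g := barRestrict (A := A) {(1 : Fin (n + 3))}
  -- All the remaining vertices form one piece, so that three summands suffice in every degree.
  let h := barRestrict (A := A) ({0, 1}ᶜ : Finset (Fin (n + 3)))
  have hid : f + g + h = 𝟙 _ := by
    refine AddCommGrpCat.hom_ext (AddMonoidHom.ext fun u => pointedFun_ext (A := A) fun j => ?_)
    change (if j ∈ ({0} : Finset (Fin (n + 3))) then u.1 j.succ else 0) +
      (if j ∈ ({1} : Finset (Fin (n + 3))) then u.1 j.succ else 0) +
      (if j ∈ ({0, 1}ᶜ : Finset (Fin (n + 3))) then u.1 j.succ else 0) = u.1 j.succ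
    by_cases h0 : j = 0
    · simp [h0]
    · by_cases h1 : j = 1 <;> simp [h0, h1]
  have h2 : (2 : Fin (n + 3)) ≠ 0 ∧ (2 : Fin (n + 3)) ≠ 1 ∧ (0 : Fin (n + 3)) ≠ 1 := by
    have : 2 % (n + 3) = 2 := Nat.mod_eq_of_lt (by omega)
    refine ⟨?_, ?_, ?_⟩ <;> simp [Fin.ext_iff, this]
  have hv : ∀ (S : Finset (Fin (n + 3))) (i) (_ : i ∉ S) (u : pointedFun A (n + 3)),
      (∀ j ≠ i, u.1 j.succ = 0) → (barRestrict (A := A) S).hom u = 0 := fun S i hi u hu => by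
    refine pointedFun_ext (A := A) fun j => ?_
    rw [barRestrict_apply]
    split_ifs with hj
    · exact hu j fun e => hi (e ▸ hj)
    · rfl
  have hf2 := hv {0} 2 (by simp [h2])
  have hg2 := hv {1} 2 (by simp [h2])
  have hf1 := hv {0} 1 (by simp [h2.2.2.symm])
  have hg0 := hv {1} 0 (by simp [h2])
  have hh0 := hv {0, 1}ᶜ 0 (by simp)
  have hh1 := hv {0, 1}ᶜ 1 (by simp)
  have hadd : ∀ {φ ψ : (bar.obj A).obj (op ⦋n + 3⦌) ⟶ (bar.obj A).obj (op ⦋n + 3⦌)}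
      {u : pointedFun A (n + 3)}, φ.hom u = 0 → ψ.hom u = 0 → (φ + ψ).hom u = 0 :=
    fun h h' => (congrArg₂ (· + ·) h h').trans (add_zero _)
  have key := congrArg (fun t : F.obj _ ⟶ F.obj _ => t.hom y) (hF.map_add_add f g h)
  have key' : (F.map (f + g + h)).hom y + (F.map f).hom y + (F.map g).hom y + (F.map h).hom y =
      (F.map (f + g)).hom y + (F.map (f + h)).hom y + (F.map (g + h)).hom y := key
  -- The index given to each term is one that it ignores: `2` for `f`, `g` and `f + g`, `0` for `h`
  -- and `g + h`, and `1` for `f + h`.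
  rw [map_apply_eq_zero_of_face F 2 hf2 (hd 2), map_apply_eq_zero_of_face F 2 hg2 (hd 2),
    map_apply_eq_zero_of_face F 0 hh0 (hd 0),
    map_apply_eq_zero_of_face F 2 (fun u hu => hadd (hf2 u hu) (hg2 u hu)) (hd 2),
    map_apply_eq_zero_of_face F 1 (fun u hu => hadd (hf1 u hu) (hh1 u hu)) (hd 1),
    map_apply_eq_zero_of_face F 0 (fun u hu => hadd (hg0 u hu) (hh0 u hu)) (hd 0), hid,
    F.map_id] at key'
  simp only [add_zero] at key'
  exact key'

/-- The simplex of `K(A, 1)` with a single nonzero value. -/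
def vertex {n : ℕ} (j : Fin n) : A →+ (bar.obj A).obj (op ⦋n⦌) where
  toFun a := (⟨Fin.cons 0 (Pi.single j a), rfl⟩ : pointedFun A n)
  map_zero' := pointedFun_ext (A := A) fun k => by
    change (Pi.single j (0 : A) : Fin n → A) k = 0
    simp
  map_add' a b := pointedFun_ext (A := A) fun k => by
    change (Pi.single j (a + b) : Fin n → A) k =
      (Pi.single j a : Fin n → A) k + (Pi.single j b : Fin n → A) k
    rw [Pi.single_add]; rfl

lemma bar_map_vertex (f : A ⟶ B) {n : ℕ} (j : Fin n) (a : A) :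
    ((bar.map f).app (op ⦋n⦌)).hom (vertex j a) = vertex j (f.hom a) :=
  pointedFun_ext (A := B) fun k =>
    Pi.apply_single (fun _ => f.hom) (fun _ => map_zero _) j a k

lemma δ_one_vertex_zero (a : A) :
    ((bar.obj A).δ (1 : Fin 3)).hom (vertex (0 : Fin 2) a) = 0 :=
  pointedFun_ext (A := A) fun j => by
    obtain rfl : j = 0 := Subsingleton.elim _ _
    exact sub_zero (0 : A)

lemma δ_one_vertex_one (a : A) :
    ((bar.obj A).δ (1 : Fin 3)).hom (vertex (1 : Fin 2) a) = vertex (0 : Fin 1) a :=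
  pointedFun_ext (A := A) fun j => by
    obtain rfl : j = 0 := Subsingleton.elim _ _
    exact sub_zero a

lemma δ_two_vertex_zero (a : A) :
    ((bar.obj A).δ (2 : Fin 3)).hom (vertex (0 : Fin 2) a) = vertex (0 : Fin 1) a :=
  pointedFun_ext (A := A) fun j => by
    obtain rfl : j = 0 := Subsingleton.elim _ _
    exact sub_zero a

lemma δ_two_vertex_one (a : A) :
    ((bar.obj A).δ (2 : Fin 3)).hom (vertex (1 : Fin 2) a) = 0 :=
  pointedFun_ext (A := A) fun j => by
    obtain rfl : j = 0 := Subsingleton.elim _ _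
    exact sub_zero (0 : A)

/-- The zeroth face moves the base point to the vertex where the value is `a`, and subtracts it.
This is the source of the sign in the differentials below. -/
lemma δ_zero_vertex_zero (a : A) :
    ((bar.obj A).δ (0 : Fin 3)).hom (vertex (0 : Fin 2) a) = - vertex (0 : Fin 1) a :=
  pointedFun_ext (A := A) fun j => by
    obtain rfl : j = 0 := Subsingleton.elim _ _
    exact zero_sub a

lemma δ_zero_vertex_one (a : A) :
    ((bar.obj A).δ (0 : Fin 3)).hom (vertex (1 : Fin 2) a) = vertex (0 : Fin 1) a :=
  pointedFun_ext (A := A) fun j => by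
    obtain rfl : j = 0 := Subsingleton.elim _ _
    exact sub_zero a

lemma bar_zero_eq_zero (u : (bar.obj A).obj (op ⦋0⦌)) : u = 0 :=
  pointedFun_ext (A := A) fun j => j.elim0

end QuadraticMoore

section Models

open Abelian.DoldKan Opposite Simplicial

/-! ### The second divided power and the symmetric square of `K(A, 1)` -/

variable {A B : Ab.{0}}

lemma exists_moore_one (F : Ab.{0} ⥤ Ab.{0}) (y : F.obj ((bar.obj A).obj (op ⦋1⦌)))
    (hy : (F.map ((bar.obj A).δ (1 : Fin 2))).hom y = 0) :
    ∃ x, (barIncl F A 1).hom x = y :=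
  exists_barIncl_eq (n := 0) y fun i => by
    obtain rfl : i = 0 := Subsingleton.elim (α := Fin 1) _ _
    exact hy

lemma exists_moore_two (F : Ab.{0} ⥤ Ab.{0}) (y : F.obj ((bar.obj A).obj (op ⦋2⦌)))
    (h1 : (F.map ((bar.obj A).δ (1 : Fin 3))).hom y = 0)
    (h2 : (F.map ((bar.obj A).δ (2 : Fin 3))).hom y = 0) :
    ∃ x, (barIncl F A 2).hom x = y :=
  exists_barIncl_eq (n := 1) y fun i => by
    fin_cases i
    · exact h1
    · exact h2

lemma exists_gammaSqMoore (a : A) : ∃ x, (barIncl Gamma2 A 1).hom x =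
    gammaSq (vertex (0 : Fin 1) a) :=
  exists_moore_one Gamma2 _ (by
    rw [Gamma2_map_sq, bar_zero_eq_zero (((bar.obj A).δ (1 : Fin 2)).hom (vertex (0 : Fin 1) a)),
      gammaSq_zero])

/-- The element `γ₂(a)` in degree one. -/
def gammaSqMoore (a : A) : ((barPlus Gamma2).obj A).X 1 := (exists_gammaSqMoore a).choose

lemma incl_gammaSqMoore (a : A) : (barIncl Gamma2 A 1).hom (gammaSqMoore a) =
    gammaSq (vertex (0 : Fin 1) a) := (exists_gammaSqMoore a).choose_spec

lemma exists_gammaCross (a b : A) : ∃ x, (barIncl Gamma2 A 2).hom x =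
    gammaMul (vertex (0 : Fin 2) a) (vertex (1 : Fin 2) b) :=
  exists_moore_two Gamma2 _
    (by rw [Gamma2_map_mul, δ_one_vertex_zero, map_zero, AddMonoidHom.zero_apply])
    (by rw [Gamma2_map_mul, δ_two_vertex_one, map_zero])

/-- The element in degree two that corresponds to `a ⊗ b`. -/
def gammaCross (a b : A) : ((barPlus Gamma2).obj A).X 2 := (exists_gammaCross a b).choose

lemma incl_gammaCross (a b : A) : (barIncl Gamma2 A 2).hom (gammaCross a b) =
    gammaMul (vertex (0 : Fin 2) a) (vertex (1 : Fin 2) b) := (exists_gammaCross a b).choose_spec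

lemma incl_d_gammaCross (a b : A) :
    (barIncl Gamma2 A 1).hom
        ((((barPlus Gamma2).obj A).d 2 1).hom (gammaCross a b)) =
      - gammaMul (vertex (0 : Fin 1) a) (vertex (0 : Fin 1) b) := by
  refine (barIncl_d _).trans ?_
  rw [incl_gammaCross]
  refine (Gamma2_map_mul ((bar.obj A).δ (0 : Fin 3)) _ _).trans ?_
  rw [δ_zero_vertex_zero, δ_zero_vertex_one, map_neg, AddMonoidHom.neg_apply]

/-- The factor two is the identity `γ₁(a)² = 2 γ₂(a)`; it makes `(a ⊗ a, γ₂(a))` a cycle with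
coefficients in `ℤ/2`. -/
lemma d_gammaCross_self (a : A) :
    (((barPlus Gamma2).obj A).d 2 1).hom (gammaCross a a) = - (2 • gammaSqMoore a) := by
  apply barIncl_injective
  rw [incl_d_gammaCross, map_neg, map_nsmul, incl_gammaSqMoore, gammaMul_self, ofNat_zsmul]

lemma Gamma2_obj_eq_zero (h : ∀ x : A, x = 0) (z : Gamma2.obj A) : z = 0 := by
  induction z using gammaTwo_induction with
  | sq x => rw [h x, gammaSq_zero]
  | mul x y => rw [h x, map_zero, AddMonoidHom.zero_apply]
  | zero => rfl
  | add x y hx hy => rw [hx, hy, add_zero]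
  | smul n x hx => rw [hx, smul_zero]

lemma SP2_obj_eq_zero (h : ∀ x : A, x = 0) (z : SP2.obj A) : z = 0 := by
  induction z using symSquare_induction with
  | mul x y => rw [h x, map_zero, AddMonoidHom.zero_apply]
  | zero => rfl
  | add x y hx hy => rw [hx, hy, add_zero]
  | smul n x hx => rw [hx, smul_zero]

lemma moore_Gamma2_zero_eq_zero (x : ((barPlus Gamma2).obj A).X 0) : x = 0 := by
  apply barIncl_injective
  rw [map_zero]
  exact Gamma2_obj_eq_zero bar_zero_eq_zero _

lemma moore_SP2_zero_eq_zero (x : ((barPlus SP2).obj A).X 0) : x = 0 := by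
  apply barIncl_injective
  rw [map_zero]
  exact SP2_obj_eq_zero bar_zero_eq_zero _

lemma gammaCross_cycle (a : A) : (((barPlus Gamma2).obj A).d 2 1).hom (gammaCross a a) +
    2 • gammaSqMoore a = 0 := by rw [d_gammaCross_self, neg_add_cancel]

/-- The class of `(a ⊗ a, γ₂(a))` in the homology with coefficients in `ℤ/2`. -/
def gammaClass (a : A) : ModTwoH ((barPlus Gamma2).obj A) :=
  modTwoClass (gammaCross a a) (gammaSqMoore a)
    (gammaCross_cycle a) (moore_Gamma2_zero_eq_zero _)

/-- The chosen representatives are determined by their images under the injective `barIncl`, where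
naturality is visible on vertices. -/
lemma modTwoHMap_gammaClass (f : A ⟶ B) (a : A) :
    modTwoHMap ((barPlus Gamma2).map f) (gammaClass a) = gammaClass (f.hom a) := by
  refine (modTwoHMap_class ((barPlus Gamma2).map f)).trans (modTwoClass_congr ?_ ?_)
  · apply barIncl_injective
    refine (barIncl_map _ _ _).trans ?_
    rw [incl_gammaCross, incl_gammaCross]
    refine (Gamma2_map_mul ((bar.map f).app _) _ _).trans ?_
    rw [bar_map_vertex, bar_map_vertex]
  · apply barIncl_injective
    refine (barIncl_map _ _ _).trans ?_
    rw [incl_gammaSqMoore, incl_gammaSqMoore]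
    refine (Gamma2_map_sq ((bar.map f).app _) _).trans ?_
    rw [bar_map_vertex]

lemma exists_symMulMoore (a b : A) : ∃ x, (barIncl SP2 A 1).hom x =
    symMul (vertex (0 : Fin 1) a) (vertex (0 : Fin 1) b) :=
  exists_moore_one SP2 _ (by
    rw [SP2_map_mul, bar_zero_eq_zero (((bar.obj A).δ (1 : Fin 2)).hom (vertex (0 : Fin 1) a)),
      map_zero, AddMonoidHom.zero_apply])

lemma exists_symCross (a b : A) : ∃ x, (barIncl SP2 A 2).hom x =
    symMul (vertex (0 : Fin 2) a) (vertex (1 : Fin 2) b) :=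
  exists_moore_two SP2 _
    (by rw [SP2_map_mul, δ_one_vertex_zero, map_zero, AddMonoidHom.zero_apply])
    (by rw [SP2_map_mul, δ_two_vertex_one, map_zero])

lemma incl_d_symCross {a b : A} {x : ((barPlus SP2).obj A).X 2}
    (hx : (barIncl SP2 A 2).hom x =
      symMul (vertex (0 : Fin 2) a) (vertex (1 : Fin 2) b)) :
    (barIncl SP2 A 1).hom ((((barPlus SP2).obj A).d 2 1).hom x) =
      - symMul (vertex (0 : Fin 1) a) (vertex (0 : Fin 1) b) := by
  refine (barIncl_d _).trans ?_
  rw [hx]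
  refine (SP2_map_mul ((bar.obj A).δ (0 : Fin 3)) _ _).trans ?_
  rw [δ_zero_vertex_zero, δ_zero_vertex_one, map_neg, AddMonoidHom.neg_apply]

lemma gammaClass_add_sub (a b : A) : ∃ h h', gammaClass (a + b) - gammaClass a - gammaClass b =
    modTwoClass (gammaCross (a + b) (a + b) - gammaCross a a - gammaCross b b)
      (gammaSqMoore (a + b) - gammaSqMoore a - gammaSqMoore b) h h' := by
  rw [gammaClass, gammaClass, gammaClass, modTwoClass_sub, modTwoClass_sub]
  exact ⟨_, _, rfl⟩

/-- The deviation from additivity of `gammaClass` comes from the symmetric square. -/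
lemma exists_gammaClass_add_sub (a b : A) : ∃ z : ModTwoH ((barPlus SP2).obj A),
    modTwoHMap ((barPlusMap SP2ToGamma2).app A) z =
      gammaClass (a + b) - gammaClass a - gammaClass b := by
  -- Expanding `(a + b) ⊗ (a + b)` and `γ₂(a + b)` leaves `a ⊗ b + b ⊗ a` and `γ₁(a) γ₁(b)`. All
  -- these terms lift to the symmetric square, where commutativity makes the pair a cycle.
  obtain ⟨x, hx⟩ := exists_symCross a b
  obtain ⟨x', hx'⟩ := exists_symCross b a
  obtain ⟨y, hy⟩ := exists_symMulMoore a b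
  obtain ⟨h, h', e⟩ := gammaClass_add_sub a b
  rw [e]
  refine ⟨modTwoClass (x + x') y ?_ (moore_SP2_zero_eq_zero _), ?_⟩
  · apply barIncl_injective
    rw [map_add, map_add, map_add, incl_d_symCross hx, incl_d_symCross hx', map_nsmul, hy, map_zero,
      symMul_comm (vertex 0 b), two_nsmul]
    abel
  · refine (modTwoHMap_class ((barPlusMap SP2ToGamma2).app A)).trans (modTwoClass_congr ?_ ?_)
    · apply barIncl_injective
      refine (barIncl_barPlusMap _ _ _).trans ?_
      rw [map_add, hx, hx', map_sub, map_sub, incl_gammaCross, incl_gammaCross, incl_gammaCross]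
      refine (map_add (SP2ToGamma2.app _).hom _ _).trans ?_
      rw [SP2ToGamma2_mul, SP2ToGamma2_mul]
      simp only [map_add, AddMonoidHom.add_apply]
      abel
    · apply barIncl_injective
      refine (barIncl_barPlusMap _ _ _).trans ?_
      rw [hy, map_sub, map_sub, incl_gammaSqMoore, incl_gammaSqMoore, incl_gammaSqMoore]
      refine (SP2ToGamma2_mul _ _).trans ?_
      rw [map_add, gammaSq_add]
      abel

/-- The deviation from additivity of `gammaClass` does not vanish. -/
lemma gammaClass_add_sub_ne_zero {a b : A} (l m : A →+ ℤ) (hla : l a = 1) (hlb : l b = 0)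
    (hma : m a = 0) (hmb : m b = 1) :
    gammaClass (a + b) - gammaClass a - gammaClass b ≠ 0 := by
  intro h
  obtain ⟨_, _, e⟩ := gammaClass_add_sub a b
  rw [e] at h
  obtain ⟨w, v, h1, -⟩ := modTwoClass_eq_zero_iff.1 h
  -- There are no chains of degree three, so the degree-two component would have to be divisible by
  -- two.
  rw [isQuadratic_Gamma2.moore_eq_zero 0 w, map_zero, zero_add] at h1
  have h2 := congrArg (barIncl Gamma2 A 2).hom h1
  rw [map_sub, map_sub, incl_gammaCross, incl_gammaCross, incl_gammaCross, map_nsmul] at h2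
  -- With `l` read at the first vertex and `m` at the second, polarizing `gammaEval` extracts the
  -- coefficient of `a ⊗ b`. It is `1` on the left of `h2`, and twice the integer `k` on the right.
  let l' : (bar.obj A).obj (op ⦋2⦌) →+ ℤ := l.comp (barEval A 2 1).hom
  let m' : (bar.obj A).obj (op ⦋2⦌) →+ ℤ := m.comp (barEval A 2 2).hom
  have hl0 : ∀ c : A, l' (vertex (0 : Fin 2) c) = l c := fun c => rfl
  have hl1 : ∀ c : A, l' (vertex (1 : Fin 2) c) = 0 := fun c => map_zero l
  have hm0 : ∀ c : A, m' (vertex (0 : Fin 2) c) = 0 := fun c => map_zero m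
  have hm1 : ∀ c : A, m' (vertex (1 : Fin 2) c) = m c := fun c => rfl
  obtain ⟨k, hk⟩ := exists_polar_gammaEval l' m' ((barIncl Gamma2 A 2).hom v)
  have e := fun p : (bar.obj A).obj (op ⦋2⦌) →+ ℤ => congrArg (gammaEval p) h2
  have e1 := e (l' + m')
  have e2 := e l'
  have e3 := e m'
  simp only [map_sub, map_nsmul, gammaEval_mul, AddMonoidHom.add_apply, hl0, hl1, hm0, hm1, map_add,
    hla, hlb, hma, hmb] at e1 e2 e3
  simp only [nsmul_eq_mul] at e1 e2 e3
  have : (1 : ℚ) = 2 * k := by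
    rw [← hk, mul_sub, mul_sub]
    push_cast at e1 e2 e3
    linarith
  have : (1 : ℤ) = 2 * k := by exact_mod_cast this
  omega

end Models

/-! ### The complexes of `Γ₂` and `SP²` on `K(ℤ, 1)`. -/

section Integers

open Abelian.DoldKan Opposite Simplicial

/-- The group of integers. -/
abbrev intGrp : Ab.{0} := AddCommGrpCat.of ℤ

lemma vertex_one_span (u : (bar.obj intGrp).obj (op ⦋1⦌)) :
    ∃ a b : ℤ, u = a • vertex (0 : Fin 1) (1 : ℤ) + b • 0 := by
  refine ⟨(u : pointedFun ℤ 1).1 1, 0, ?_⟩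
  rw [← map_zsmul, smul_zero, add_zero]
  refine pointedFun_ext (A := ℤ) fun j => ?_
  obtain rfl : j = 0 := Subsingleton.elim _ _
  exact (mul_one _).symm

lemma vertex_two_span (u : (bar.obj intGrp).obj (op ⦋2⦌)) :
    ∃ a b : ℤ, u = a • vertex (0 : Fin 2) (1 : ℤ) + b • vertex (1 : Fin 2) (1 : ℤ) := by
  refine ⟨(u : pointedFun ℤ 2).1 1, (u : pointedFun ℤ 2).1 2, ?_⟩
  rw [← map_zsmul, ← map_zsmul]
  refine pointedFun_ext (A := ℤ) fun j => ?_
  fin_cases j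
  · exact ((add_zero _).trans (mul_one _)).symm
  · exact ((zero_add _).trans (mul_one _)).symm

lemma barEval_vertex : (barEval intGrp 1 1).hom (vertex (0 : Fin 1) (1 : ℤ)) = (1 : ℤ) := rfl

lemma moore_Gamma2_one (y : ((barPlus Gamma2).obj intGrp).X 1) :
    ∃ k : ℤ, y = k • gammaSqMoore (A := intGrp) (1 : ℤ) := by
  obtain ⟨a, b, c, h⟩ := gammaTwo_exists_coeff vertex_one_span
    ((barIncl Gamma2 intGrp 1).hom y)
  refine ⟨a, barIncl_injective (h.trans ?_)⟩
  rw [map_zsmul, incl_gammaSqMoore, gammaSq_zero, map_zero, smul_zero, smul_zero, add_zero, add_zero]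

/-- Each of the two positive faces retains exactly one square term, so both square coefficients
vanish and only the cross term is left. -/
lemma moore_Gamma2_two (x : ((barPlus Gamma2).obj intGrp).X 2) :
    ∃ k : ℤ, x = k • gammaCross (A := intGrp) (1 : ℤ) (1 : ℤ) := by
  obtain ⟨a, b, c, h⟩ := gammaTwo_exists_coeff vertex_two_span
    ((barIncl Gamma2 intGrp 2).hom x)
  have h1 : (Gamma2.map ((bar.obj intGrp).δ (1 : Fin 3))).hom
    ((barIncl Gamma2 intGrp 2).hom x) = 0 := map_δ_barIncl (0 : Fin 2) x
  have h2 : (Gamma2.map ((bar.obj intGrp).δ (2 : Fin 3))).hom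
    ((barIncl Gamma2 intGrp 2).hom x) = 0 := map_δ_barIncl (1 : Fin 2) x
  rw [h, map_add, map_add, map_zsmul, map_zsmul, map_zsmul, Gamma2_map_sq, Gamma2_map_sq,
    Gamma2_map_mul, δ_one_vertex_zero, δ_one_vertex_one, gammaSq_zero, map_zero,
    AddMonoidHom.zero_apply, smul_zero, smul_zero, zero_add, zero_add] at h1
  rw [h, map_add, map_add, map_zsmul, map_zsmul, map_zsmul, Gamma2_map_sq, Gamma2_map_sq,
    Gamma2_map_mul, δ_two_vertex_zero, δ_two_vertex_one, gammaSq_zero, map_zero,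
    smul_zero, smul_zero, add_zero, add_zero] at h2
  have hc := gammaSq_zsmul_eq_zero (l := (barEval intGrp 1 1).hom) barEval_vertex h1
  have ha := gammaSq_zsmul_eq_zero (l := (barEval intGrp 1 1).hom) barEval_vertex h2
  refine ⟨b, barIncl_injective (h.trans ?_)⟩
  rw [map_zsmul, incl_gammaCross, ha, hc, zero_smul, zero_smul, zero_add, add_zero]

lemma gammaSqMoore_zsmul_eq_zero {k : ℤ} (h : k • gammaSqMoore (A := intGrp) (1 : ℤ) = 0) :
    k = 0 := by
  have := congrArg (barIncl Gamma2 intGrp 1).hom h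
  rw [map_zsmul, incl_gammaSqMoore, map_zero] at this
  exact gammaSq_zsmul_eq_zero (l := (barEval intGrp 1 1).hom) barEval_vertex this

/-- The homology of `Γ₂(K(ℤ, 1))` with coefficients in `ℤ/2` has at most two elements. -/
lemma modTwoH_Gamma2_int (z : ModTwoH ((barPlus Gamma2).obj intGrp)) :
    z = 0 ∨ z = gammaClass (A := intGrp) (1 : ℤ) := by
  obtain ⟨x, y, h, h', rfl⟩ := modTwoH_cases z
  obtain ⟨k, rfl⟩ := moore_Gamma2_two x
  obtain ⟨l, rfl⟩ := moore_Gamma2_one y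
  -- The cycle condition reads `2 (l - k) γ₂(1) = 0`, and `γ₂(1)` has no torsion.
  have hkl : l = k := by
    have h := h
    change (((barPlus Gamma2).obj intGrp).d 2 1).hom (k • gammaCross (A := intGrp) (1 : ℤ) (1 : ℤ))
      + 2 • l • gammaSqMoore (A := intGrp) (1 : ℤ) = 0 at h
    rw [map_zsmul, d_gammaCross_self] at h
    have h3 : (2 * (l - k)) • gammaSqMoore (A := intGrp) (1 : ℤ) = 0 := by
      rw [← h]; module
    have := gammaSqMoore_zsmul_eq_zero h3
    omega
  subst hkl
  -- By `d_gammaCross_self`, the boundary given by `v = n • gammaCross 1 1` is `2n` times the basic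
  -- cycle, so only the parity of `l` matters.
  rcases Int.even_or_odd' l with ⟨n, rfl | rfl⟩
  · left
    refine modTwoClass_eq_zero_iff.2 ⟨0, n • gammaCross (A := intGrp) (1 : ℤ) (1 : ℤ), ?_, ?_⟩
    · rw [map_zero, zero_add]
      module
    · rw [map_zsmul, d_gammaCross_self]
      module
  · right
    rw [← sub_eq_zero, gammaClass, modTwoClass_sub]
    refine modTwoClass_eq_zero_iff.2 ⟨0, n • gammaCross (A := intGrp) (1 : ℤ) (1 : ℤ), ?_, ?_⟩
    · rw [map_zero, zero_add]
      module
    · rw [map_zsmul, d_gammaCross_self]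
      module

/-- The positive faces leave only a multiple of the cross term, whose differential is the same
multiple of `-e²`, with `e²` torsion-free. -/
lemma moore_SP2_two (x : ((barPlus SP2).obj intGrp).X 2)
    (hx : (((barPlus SP2).obj intGrp).d 2 1).hom x = 0) : x = 0 := by
  obtain ⟨a, b, c, h⟩ := symSquare_exists_coeff vertex_two_span
    ((barIncl SP2 intGrp 2).hom x)
  have h1 : (SP2.map ((bar.obj intGrp).δ (1 : Fin 3))).hom
    ((barIncl SP2 intGrp 2).hom x) = 0 := map_δ_barIncl (0 : Fin 2) x
  have h2 : (SP2.map ((bar.obj intGrp).δ (2 : Fin 3))).hom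
    ((barIncl SP2 intGrp 2).hom x) = 0 := map_δ_barIncl (1 : Fin 2) x
  have h0 : (SP2.map ((bar.obj intGrp).δ (0 : Fin 3))).hom
    ((barIncl SP2 intGrp 2).hom x) = 0 :=
    (barIncl_d x).symm.trans ((congrArg _ hx).trans (map_zero _))
  rw [h, map_add, map_add, map_zsmul, map_zsmul, map_zsmul, SP2_map_mul, SP2_map_mul,
    SP2_map_mul, δ_one_vertex_zero, δ_one_vertex_one] at h1
  simp only [map_zero, AddMonoidHom.zero_apply, smul_zero, zero_add] at h1
  rw [h, map_add, map_add, map_zsmul, map_zsmul, map_zsmul, SP2_map_mul, SP2_map_mul,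
    SP2_map_mul, δ_two_vertex_zero, δ_two_vertex_one] at h2
  simp only [map_zero, smul_zero, add_zero] at h2
  have hc := symMul_self_zsmul_eq_zero (l := (barEval intGrp 1 1).hom) barEval_vertex h1
  have ha := symMul_self_zsmul_eq_zero (l := (barEval intGrp 1 1).hom) barEval_vertex h2
  rw [h, ha, hc, zero_smul, zero_smul, zero_add, add_zero, map_zsmul, SP2_map_mul,
    δ_zero_vertex_zero, δ_zero_vertex_one, map_neg, AddMonoidHom.neg_apply, smul_neg, neg_eq_zero]
    at h0
  have hb := symMul_self_zsmul_eq_zero (l := (barEval intGrp 1 1).hom) barEval_vertex h0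
  refine barIncl_injective (h.trans ?_)
  rw [ha, hb, hc, zero_smul, zero_smul, zero_smul, add_zero, add_zero, map_zero]

/-- Here the generator `e²` is itself a boundary, whereas for `Γ₂` only `γ₁(e)² = 2 γ₂(e)` is. This
is where the two functors part. -/
lemma moore_SP2_one (y : ((barPlus SP2).obj intGrp).X 1) :
    ∃ x, (((barPlus SP2).obj intGrp).d 2 1).hom x = y := by
  obtain ⟨a, b, c, h⟩ := symSquare_exists_coeff vertex_one_span
    ((barIncl SP2 intGrp 1).hom y)
  obtain ⟨x, hx⟩ := exists_symCross (A := intGrp) (1 : ℤ) (1 : ℤ)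
  refine ⟨(-a) • x, barIncl_injective (Eq.trans ?_ h.symm)⟩
  rw [map_zsmul, map_zsmul, incl_d_symCross hx, map_zero, map_zero, smul_zero, smul_zero, add_zero,
    add_zero, neg_smul_neg]

/-- `LSP²` vanishes on `ℤ[1]`. -/
lemma exactAt_SP2_int (n : ℕ) : ((barPlus SP2).obj intGrp).ExactAt n := by
  have key : ∀ {i j k : ℕ}, (ComplexShape.down ℕ).prev j = i → (ComplexShape.down ℕ).next j = k →
      (∀ x : ((barPlus SP2).obj intGrp).X j, (((barPlus SP2).obj intGrp).d j k).hom x = 0 →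
        ∃ y, (((barPlus SP2).obj intGrp).d i j).hom y = x) →
      ((barPlus SP2).obj intGrp).ExactAt j := fun {i j k} hi hk h => by
    rw [HomologicalComplex.exactAt_iff' _ i j k hi hk, ShortComplex.ab_exact_iff]
    exact h
  match n with
  | 0 => exact key (i := 1) (k := 0) (by simp) (by simp) fun x _ =>
      ⟨0, (map_zero _).trans (moore_SP2_zero_eq_zero x).symm⟩
  | 1 => exact key (i := 2) (k := 0) (by simp) (by simp) fun x _ => moore_SP2_one x
  | 2 => exact key (i := 3) (k := 1) (by simp) (by simp) fun x hx =>
      ⟨0, (map_zero _).trans (moore_SP2_two x hx).symm⟩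
  | n + 3 => exact key (i := n + 4) (k := n + 2) (by simp) (by simp) fun x _ =>
      ⟨0, (map_zero _).trans (isQuadratic_SP2.moore_eq_zero n x).symm⟩

end Integers

section Nonsplitting

open Abelian.DoldKan TensorProduct

/-! ### The functors on the shifts of `ℤ` and `ℤ²` -/

instance : (N (A := Ab.{0})).Additive :=
  Functor.additive_of_preserves_binary_products _

/-- The second homology with coefficients in `ℤ/2` of `A[1] ⊗ ℤ/2`. -/
def tensorModel : Ab.{0} ⥤ Ab.{0} :=
  bar ⋙ N ⋙ tensorZModTwo.mapHomologicalComplex (ComplexShape.down ℕ) ⋙ modTwoHomology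

instance : tensorModel.Additive :=
  inferInstanceAs (bar ⋙ N ⋙ tensorZModTwo.mapHomologicalComplex (ComplexShape.down ℕ) ⋙
    modTwoHomology).Additive

/-- The complex is `ℤ/2` in degree one. Its generator, placed in the second component, is a cycle
because `2` kills it, and there is no degree-two chain to bound it. -/
lemma exists_tensorModel_int_ne_zero : ∃ z : tensorModel.obj intGrp, z ≠ 0 := by
  let M : Ch := (tensorZModTwo.mapHomologicalComplex (ComplexShape.down ℕ)).obj
    (N.obj (bar.obj intGrp))
  have hM : ∀ n, n ≠ 1 → ∀ x : M.X n, x = 0 := fun n hn x => by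
    have h : Limits.IsZero (M.X n) := tensorZModTwo.map_isZero (isZero_moore_bar intGrp n hn)
    have := AddCommGrpCat.subsingleton_of_isZero h
    exact Subsingleton.elim _ _
  let c : (N.obj (bar.obj intGrp)).X 1 := (inv (mooreBarEval intGrp)).hom (1 : ℤ)
  let y : M.X 1 := c ⊗ₜ[ℤ] (1 : ZMod 2)
  have hc : (mooreBarEval intGrp).hom c = (1 : ℤ) :=
    congrArg (fun f : intGrp ⟶ intGrp => f.hom (1 : ℤ)) (IsIso.inv_hom_id (mooreBarEval intGrp))
  have hy : 2 • y = 0 := (ofNat_zsmul y 2).symm.trans (two_zsmul_tensor _)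
  refine ⟨(modTwoClass (X := M) 0 y (by rw [map_zero, zero_add, hy]) (hM 0 (by simp) _) :
    ModTwoH M), fun h => ?_⟩
  obtain ⟨w, v, -, h2⟩ := modTwoClass_eq_zero_iff.1 h
  rw [hM 2 (by simp) v, map_zero, neg_zero] at h2
  have h3 := congrArg (tensorZModTwo.map (mooreBarEval intGrp)).hom h2
  have h4 : (tensorZModTwo.map (mooreBarEval intGrp)).hom y = (1 : ℤ) ⊗ₜ[ℤ] (1 : ZMod 2) :=
    congrArg (· ⊗ₜ[ℤ] (1 : ZMod 2)) hc
  have h5 := congrArg (TensorProduct.lid ℤ (ZMod 2)) (h4.symm.trans (h3.trans (map_zero _)))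
  have h6 : TensorProduct.lid ℤ (ZMod 2) ((1 : ℤ) ⊗ₜ[ℤ] (1 : ZMod 2)) = 1 := by simp
  have h7 : (1 : ZMod 2) = 0 := h6.symm.trans (h5.trans (map_zero _))
  exact one_ne_zero h7

/-- The derived functor of `F` on `A[1]`, in homology with coefficients in `ℤ/2`. -/
def derivedToModel (F : Ab.{0} ⥤ Ab.{0}) :
    (inDegreeZero ⋙ shift ⋙ leftDerived F) ⋙ derivedModTwoHomology ⟶ barPlus F ⋙ modTwoHomology :=
  (Functor.whiskerRight (leftDerivedComparison F) derivedModTwoHomology :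
    _ ⟶ barPlus F ⋙ Q ⋙ derivedModTwoHomology) ≫
    Functor.whiskerLeft (barPlus F) derivedModTwoHomologyFac.hom

lemma bijective_derivedToModel (F : Ab.{0} ⥤ Ab.{0}) (A : Ab.{0}) [Module.Free ℤ A]
    [Module.Finite ℤ A] : Function.Bijective ((derivedToModel F).app A).hom := by
  have := isIso_leftDerivedComparison_app F A
  have : IsIso ((derivedToModel F).app A) := inferInstanceAs (IsIso
    (derivedModTwoHomology.map ((leftDerivedComparison F).app A) ≫
      derivedModTwoHomologyFac.hom.app _))
  exact ConcreteCategory.bijective_of_isIso ((derivedToModel F).app A)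

/-- `A[1] ⊗ᴸ ℤ/2` in homology with coefficients in `ℤ/2`. -/
def derivedTensorToModel :
    (inDegreeZero ⋙ suspendedTensor) ⋙ derivedModTwoHomology ⟶ tensorModel :=
  (Functor.whiskerRight (leftDerivable_map tensorZModTwo).barComparison derivedModTwoHomology :
    _ ⟶ (bar ⋙ N ⋙ tensorZModTwo.mapHomologicalComplex (ComplexShape.down ℕ)) ⋙ Q ⋙
      derivedModTwoHomology) ≫
    Functor.whiskerLeft (bar ⋙ N ⋙ tensorZModTwo.mapHomologicalComplex (ComplexShape.down ℕ))
      derivedModTwoHomologyFac.hom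

lemma isIso_derivedTensorToModel_app (A : Ab.{0}) [Module.Free ℤ A] [Module.Finite ℤ A] :
    IsIso (derivedTensorToModel.app A) := by
  have := (leftDerivable_map tensorZModTwo).isIso_barComparison_app A
  exact inferInstanceAs (IsIso
    (derivedModTwoHomology.map ((leftDerivable_map tensorZModTwo).barComparison.app A) ≫
      derivedModTwoHomologyFac.hom.app _))

/-- This transfers additivity to a functor defined through the derived category, where the
comparison with an additive model is known to be invertible only on suitable groups. -/
lemma map_add_of_mono {Φ M : Ab.{0} ⥤ Ab.{0}} [M.Additive] (κ : Φ ⟶ M) {A B : Ab.{0}}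
    [Mono (κ.app B)] (f g : A ⟶ B) : Φ.map (f + g) = Φ.map f + Φ.map g := by
  rw [← cancel_mono (κ.app B), Preadditive.add_comp, κ.naturality, κ.naturality, κ.naturality,
    M.map_add, Preadditive.comp_add]

/-- The group `ℤ²`. -/
abbrev intSq : Ab.{0} := AddCommGrpCat.of (ℤ × ℤ)

/-- The first inclusion of `ℤ` into `ℤ²`. -/
abbrev intInl : intGrp ⟶ intSq := AddCommGrpCat.ofHom (AddMonoidHom.inl ℤ ℤ)

/-- The second inclusion of `ℤ` into `ℤ²`. -/
abbrev intInr : intGrp ⟶ intSq := AddCommGrpCat.ofHom (AddMonoidHom.inr ℤ ℤ)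

/-- The class `gammaClass` at the generator of `ℤ`. -/
def gammaGen : (barPlus Gamma2 ⋙ modTwoHomology).obj intGrp := gammaClass (A := intGrp) (1 : ℤ)

/-- The deviation from additivity of `gammaClass` on the basis of `ℤ²`. -/
def gammaDeviation : (barPlus Gamma2 ⋙ modTwoHomology).obj intSq :=
  ((barPlus Gamma2 ⋙ modTwoHomology).map (intInl + intInr)).hom gammaGen -
    ((barPlus Gamma2 ⋙ modTwoHomology).map intInl).hom gammaGen -
    ((barPlus Gamma2 ⋙ modTwoHomology).map intInr).hom gammaGen

lemma gammaDeviation_eq : gammaDeviation =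
    (gammaClass (A := intSq) (((1, 0) : ℤ × ℤ) + ((0, 1) : ℤ × ℤ)) -
    gammaClass (A := intSq) ((1, 0) : ℤ × ℤ) - gammaClass (A := intSq) ((0, 1) : ℤ × ℤ) :
      ModTwoH ((barPlus Gamma2).obj intSq)) :=
  congrArg₂ (· - ·) (congrArg₂ (· - ·) (modTwoHMap_gammaClass (intInl + intInr) (1 : ℤ))
    (modTwoHMap_gammaClass intInl (1 : ℤ))) (modTwoHMap_gammaClass intInr (1 : ℤ))

lemma gammaDeviation_ne_zero : gammaDeviation ≠ 0 := by
  rw [gammaDeviation_eq]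
  exact gammaClass_add_sub_ne_zero (A := intSq) (AddMonoidHom.fst ℤ ℤ) (AddMonoidHom.snd ℤ ℤ)
    rfl rfl rfl rfl

/-- No natural transformation is injective on `ℤ[0]` in homology with coefficients in `ℤ/2`. -/
lemma false_of_injective (v : suspendedTensor ⟶ suspendedLGamma2)
    (hv : Function.Injective
      (derivedModTwoHomology.map (v.app (inDegreeZero.obj intGrp))).hom) : False := by
  let Φ := (inDegreeZero ⋙ suspendedTensor) ⋙ derivedModTwoHomology
  let η : Φ ⟶ barPlus Gamma2 ⋙ modTwoHomology :=
    (Functor.whiskerRight (Functor.whiskerLeft inDegreeZero v) derivedModTwoHomology : Φ ⟶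
      (inDegreeZero ⋙ shift ⋙ leftDerived Gamma2) ⋙ derivedModTwoHomology) ≫ derivedToModel Gamma2
  have h1 := isIso_derivedTensorToModel_app intGrp
  have h2 := isIso_derivedTensorToModel_app intSq
  obtain ⟨z, hz⟩ := exists_tensorModel_int_ne_zero
  obtain ⟨t, rfl⟩ := (ConcreteCategory.bijective_of_isIso (derivedTensorToModel.app intGrp)).2 z
  have hη : Function.Injective (η.app intGrp).hom :=
    (bijective_derivedToModel Gamma2 intGrp).1.comp hv
  have ht : (η.app intGrp).hom t = gammaGen := by
    -- There are at most two classes, so injectivity forces the nonzero `t` onto `gammaGen`.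
    refine (modTwoH_Gamma2_int ((η.app intGrp).hom t)).resolve_left fun h => hz ?_
    have : t = 0 := hη (h.trans (map_zero _).symm)
    rw [this]
    exact map_zero _
  have hnat : ∀ f : intGrp ⟶ intSq, (η.app intSq).hom ((Φ.map f).hom t) =
      ((barPlus Gamma2 ⋙ modTwoHomology).map f).hom gammaGen := fun f =>
    (hom_eq_of_comp_eq (η.naturality f) t).trans (congrArg _ ht)
  -- By naturality the deviation of `gammaGen` is the image of the deviation of `t`, which vanishes
  -- because `Φ` adds morphisms into `ℤ²`.
  refine gammaDeviation_ne_zero ?_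
  rw [gammaDeviation, ← hnat, ← hnat, ← hnat, map_add_of_mono derivedTensorToModel, ← map_sub,
    ← map_sub]
  have : ((Φ.map intInl + Φ.map intInr).hom t - (Φ.map intInl).hom t - (Φ.map intInr).hom t) = 0 := by
    rw [AddCommGrpCat.hom_add_apply]; abel
  rw [this, map_zero]

lemma hom_sub_sub {A B : Ab.{0}} (f : A ⟶ B) (a b c : A) :
    f.hom (a - b - c) = f.hom a - f.hom b - f.hom c := by rw [map_sub, map_sub]

/-- Only cross terms occur in the deviation; the explicit lift to the symmetric square is
transported through the comparison isomorphisms. -/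
lemma exists_seqLeft_eq_gammaDeviation :
    ∃ w, ((derivedToModel Gamma2).app intSq).hom ((derivedModTwoHomology.map
      (seqLeft.app (inDegreeZero.obj intSq))).hom w) = gammaDeviation := by
  obtain ⟨z, hz⟩ := exists_gammaClass_add_sub (A := intSq) ((1, 0) : ℤ × ℤ) ((0, 1) : ℤ × ℤ)
  obtain ⟨w, hw⟩ := (bijective_derivedToModel SP2 intSq).2 z
  refine ⟨w, ?_⟩
  rw [gammaDeviation_eq, ← hz, ← hw]
  have e : derivedModTwoHomology.map (seqLeft.app (inDegreeZero.obj intSq)) ≫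
      (derivedToModel Gamma2).app intSq =
    (derivedToModel SP2).app intSq ≫ modTwoHomology.map ((barPlusMap SP2ToGamma2).app intSq) := by
    have h1 := congrArg derivedModTwoHomology.map
      (derivedMap_app_leftDerivedComparison SP2ToGamma2 intSq)
    replace h1 := (derivedModTwoHomology.map_comp _ _).symm.trans
      (h1.trans (derivedModTwoHomology.map_comp _ _))
    have h2 := derivedModTwoHomologyFac.hom.naturality ((barPlusMap SP2ToGamma2).app intSq)
    change _ ≫ (derivedModTwoHomology.map ((leftDerivedComparison Gamma2).app intSq) ≫
      derivedModTwoHomologyFac.hom.app _) =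
      (derivedModTwoHomology.map ((leftDerivedComparison SP2).app intSq) ≫
      derivedModTwoHomologyFac.hom.app _) ≫ _
    rw [Category.assoc, ← h2]
    exact (Category.assoc _ _ _).symm.trans ((congrArg (· ≫ _) h1).trans (Category.assoc _ _ _))
  exact hom_eq_of_comp_eq e w

/-- The deviation is built from images of one class over `ℤ`, where `LSP²` vanishes, so `r` kills
it. As it also comes from `LSP²`, it cannot be killed by a retraction unless it is zero. -/
lemma false_of_retraction (r : suspendedLGamma2 ⟶ suspendedLSP2)
    (hr : seqLeft ≫ r = 𝟙 suspendedLSP2) : False := by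
  let Θ := derivedModTwoHomology
  obtain ⟨w, hw⟩ := exists_seqLeft_eq_gammaDeviation
  obtain ⟨x, hx⟩ := (bijective_derivedToModel Gamma2 intGrp).2 gammaGen
  let F := (inDegreeZero ⋙ suspendedLGamma2) ⋙ Θ
  let G := (inDegreeZero ⋙ suspendedLSP2) ⋙ Θ
  let ρ : F ⟶ G := Functor.whiskerRight (Functor.whiskerLeft inDegreeZero r) Θ
  have hG : (ρ.app intGrp).hom x = 0 := by
    refine (bijective_derivedToModel SP2 intGrp).1 ?_
    exact (modTwoH_eq_zero_of_exactAt exactAt_SP2_int _).trans (map_zero _).symm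
  have h0 : ∀ f : intGrp ⟶ intSq, (ρ.app intSq).hom ((F.map f).hom x) = 0 := fun f =>
    (hom_eq_of_comp_eq (ρ.naturality f) x).trans ((congrArg _ hG).trans (map_zero _))
  have hnat : ∀ f : intGrp ⟶ intSq, ((derivedToModel Gamma2).app intSq).hom ((F.map f).hom x) =
      ((barPlus Gamma2 ⋙ modTwoHomology).map f).hom gammaGen := fun f =>
    (hom_eq_of_comp_eq ((derivedToModel Gamma2).naturality f) x).trans (congrArg _ hx)
  have hD : (Θ.map (seqLeft.app (inDegreeZero.obj intSq))).hom w =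
      (F.map (intInl + intInr)).hom x - (F.map intInl).hom x - (F.map intInr).hom x := by
    refine (bijective_derivedToModel Gamma2 intSq).1 (hw.trans ?_)
    refine Eq.trans ?_ (hom_sub_sub ((derivedToModel Gamma2).app intSq) _ _ _).symm
    rw [hnat, hnat, hnat, gammaDeviation]
  have hw0 : w = 0 := by
    have e : Θ.map (seqLeft.app (inDegreeZero.obj intSq)) ≫ ρ.app intSq = 𝟙 _ :=
      (Θ.map_comp _ _).symm.trans ((congrArg Θ.map
        (congrArg (fun τ => τ.app (inDegreeZero.obj intSq)) hr)).trans (Θ.map_id _))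
    refine (congrArg (fun f : Θ.obj (suspendedLSP2.obj (inDegreeZero.obj intSq)) ⟶ _ => f.hom w)
      e).symm.trans ((congrArg (ρ.app intSq).hom hD).trans ?_)
    refine (hom_sub_sub (ρ.app intSq) _ _ _).trans ?_
    rw [h0, h0, h0, sub_zero, sub_zero]
  refine gammaDeviation_ne_zero (hw.symm.trans ?_)
  rw [hw0, map_zero]
  exact map_zero _

/-- `LSP²(ℤ[1])` is an initial object of the derived category. -/
def isInitialSuspendedLSP2Int :
    Limits.IsInitial (suspendedLSP2.obj (inDegreeZero.obj intGrp)) :=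
  haveI := isIso_leftDerivedComparison_app SP2 intGrp
  (isInitialOfExactAt exactAt_SP2_int).ofIso
    (asIso ((leftDerivedComparison SP2).app intGrp)).symm

end Nonsplitting

end DerAb

end

theorem mainTheorem12 :
    -- the second map has no natural section
    (¬ ∃ s : DerAb.suspendedTensor ⟶ DerAb.suspendedLGamma2,
      s ≫ DerAb.seqRight = 𝟙 DerAb.suspendedTensor) ∧
    -- the first map has no natural retraction
    (¬ ∃ r : DerAb.suspendedLGamma2 ⟶ DerAb.suspendedLSP2,
      DerAb.seqLeft ≫ r = 𝟙 DerAb.suspendedLSP2) ∧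
    -- the middle term is not, naturally in `C`, a direct sum of the outer terms by any maps
    (¬ ∃ (u : DerAb.suspendedLSP2 ⟶ DerAb.suspendedLGamma2)
        (v : DerAb.suspendedTensor ⟶ DerAb.suspendedLGamma2),
      ∀ C : DerAb.DAb,
        Nonempty (Limits.IsColimit (Limits.BinaryCofan.mk (u.app C) (v.app C)))) := by
  refine ⟨?_, ?_, ?_⟩
  · rintro ⟨s, hs⟩
    refine DerAb.false_of_injective s ((AddCommGrpCat.mono_iff_injective _).1 ?_)
    have h := congrArg (fun τ => τ.app (DerAb.inDegreeZero.obj DerAb.intGrp)) hs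
    have : IsSplitMono (s.app (DerAb.inDegreeZero.obj DerAb.intGrp)) := ⟨⟨⟨_, h⟩⟩⟩
    infer_instance
  · rintro ⟨r, hr⟩
    exact DerAb.false_of_retraction r hr
  · rintro ⟨u, v, h⟩
    refine DerAb.false_of_injective v ((AddCommGrpCat.mono_iff_injective _).1 ?_)
    -- At `ℤ` the first summand is initial, so the second inclusion of the coproduct is an
    -- isomorphism there.
    have : IsIso (v.app (DerAb.inDegreeZero.obj DerAb.intGrp)) :=
      (Limits.BinaryCofan.isColimit_iff_isIso_inr DerAb.isInitialSuspendedLSP2Int _).1 (h _)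
    infer_instance
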